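/- Let $X$ be the space of unimodular lattices in $\mathbb{R}^2$, i.e. the subgroups $g\mathbb{Z}^2$ with $g\in \mathrm{SL}_2(\mathbb{R})$, with the quotient topology of the identification $X=\mathrm{SL}_2(\mathbb{R})/\mathrm{SL}_2(\mathbb{Z})$, $g\mapsto g\mathbb{Z}^2$. For $t\in\mathbb{R}$ let $g_t=\begin{pmatrix} e^t&0\\0&e^{-t}\end{pmatrix}$, and for $E\subseteq\mathbb{R}$ and $\Lambda\in X$ write $g_E\Lambda=\{g_t\Lambda : t\in E\}$. For $\alpha\in\mathbb{R}$ let $\Lambda_\alpha=\begin{pmatrix}1&\alpha\\0&1\end{pmatrix}\mathbb{Z}^2$. Let $\mathbf{BA}$ be the set of badly approximable numbers, i.e. the irrational real numbers whose continued fraction digits are bounded from above. A subset of $X$ is precompact if its closure in $X$ is compact. Fix a lattice $\Lambda\in X$. If $g_{\mathbb{R}}\Lambda$ is precompact in $X$, then the set $$\mathcal{S}_\Lambda:=\left\{\alpha\in\mathbf{BA} : \Lambda\in\overline{g_{\mathbb{R}_{>0}}\Lambda_\alpha}\right\}$$ has Hausdorff dimension $1$. Conversely, if $g_{\mathbb{R}}\Lambda$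 is not precompact in $X$, then for every $\alpha\in\mathbf{BA}$ there exist $t_0>0$ and a neighbourhood $U$ of $\Lambda$ in $X$ such that $$g_{\mathbb{R}_{>t_0}}\Lambda_\alpha\cap U=\varnothing.$$ -/

import Mathlib

open scoped Topology

namespace LatticeFlow

/-- The group `SL₂(ℝ)`, with the topology given by the matrix entries. -/
abbrev G : Type := Matrix.SpecialLinearGroup (Fin 2) ℝ

/-- The linear action of a matrix `g ∈ SL₂(ℝ)` on column vectors, as an additive map. -/
def linAct (g : G) : (Fin 2 → ℝ) →+ (Fin 2 → ℝ) :=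
  (g : Matrix (Fin 2) (Fin 2) ℝ).mulVecLin.toAddMonoidHom

theorem linAct_apply (g : G) (v : Fin 2 → ℝ) :
    linAct g v = (g : Matrix (Fin 2) (Fin 2) ℝ).mulVec v := rfl

theorem linAct_one : linAct 1 = AddMonoidHom.id (Fin 2 → ℝ) := by
  refine AddMonoidHom.ext fun v => ?_
  simp [linAct_apply]

theorem linAct_mul (g h : G) : linAct (g * h) = (linAct g).comp (linAct h) := by
  refine AddMonoidHom.ext fun v => ?_
  simp only [AddMonoidHom.comp_apply, linAct_apply, Matrix.SpecialLinearGroup.coe_mul,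
    Matrix.mulVec_mulVec]

/-- The standard lattice `ℤ²` in `ℝ²`: the vectors with integer coordinates. -/
def intLattice : AddSubgroup (Fin 2 → ℝ) :=
  ((Int.castAddHom ℝ).compLeft (Fin 2)).range

/-- The set `X` of unimodular lattices in `ℝ²`: the subgroups `g ℤ²` with `g ∈ SL₂(ℝ)`. -/
def X : Type :=
  {L : AddSubgroup (Fin 2 → ℝ) // ∃ g : G, L = intLattice.map (linAct g)}

/-- The orbit map `g ↦ g ℤ²`. -/
def toLattice (g : G) : X := ⟨intLattice.map (linAct g), g, rfl⟩

/-- `X` carries the quotient topology of the surjection `SL₂(ℝ) → X`, `g ↦ g ℤ²`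
(whose fibres are the cosets of `SL₂(ℤ)`, so that `X = SL₂(ℝ) / SL₂(ℤ)`). -/
instance : TopologicalSpace X := TopologicalSpace.coinduced toLattice inferInstance

/-- `SL₂(ℝ)` acts on `X` by taking the image of a lattice under the linear map. -/
instance : MulAction G X where
  smul g L := ⟨L.1.map (linAct g), by
    obtain ⟨h, hh⟩ := L.2
    exact ⟨g * h, by rw [hh, AddSubgroup.map_map, linAct_mul]⟩⟩
  one_smul L := Subtype.ext <| by
    change L.1.map (linAct 1) = L.1
    rw [linAct_one, AddSubgroup.map_id]
  mul_smul g h L := Subtype.ext <| by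
    change L.1.map (linAct (g * h)) = (L.1.map (linAct h)).map (linAct g)
    rw [AddSubgroup.map_map, linAct_mul]

/-- The diagonal matrix `g_t = diag(eᵗ, e⁻ᵗ)`. -/
noncomputable def diag (t : ℝ) : G :=
  ⟨!![Real.exp t, 0; 0, Real.exp (-t)], by simp [Matrix.det_fin_two, ← Real.exp_add]⟩

/-- The orbit piece `g_E Λ = {g_t Λ : t ∈ E}`. -/
noncomputable def orbit (E : Set ℝ) (L : X) : Set X := (fun t : ℝ => diag t • L) '' E

/-- The unipotent matrix with rows `(1, x)` and `(0, 1)`. -/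
def unip (x : ℝ) : G := ⟨!![1, x; 0, 1], by simp [Matrix.det_fin_two]⟩

/-- The lattice `Λ_α`, the image of `ℤ²` under the matrix with rows `(1, α)` and `(0, 1)`. -/
def latticeOf (α : ℝ) : X := toLattice (unip α)

/-- A set is precompact in `X` if its closure in `X` is compact. -/
def Precompact (S : Set X) : Prop := IsCompact (closure S)

/-- The set of badly approximable numbers: the irrational numbers whose continued fraction
digits (partial quotients) are bounded from above. -/
def BA : Set ℝ :=
  {α | Irrational α ∧ ∃ M : ℝ, ∀ (n : ℕ) (b : ℝ),
    (GenContFract.of α).partDens.get? n = some b → b ≤ M}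

/-- The set `S_Λ` of badly approximable `α` such that `Λ` lies in the closure of the forward
orbit of `Λ_α`. -/
def limitSet (L : X) : Set ℝ :=
  {α | α ∈ BA ∧ L ∈ closure (orbit (Set.Ioi 0) (latticeOf α))}

end LatticeFlow

/-!
A lattice `Λ` has a precompact diagonal orbit exactly when the products `x y` of the coordinates of
its nonzero vectors are bounded away from zero, and `α` is badly approximable exactly when the same
holds for the vectors of `Λ_α` off the horizontal axis (`exists_isBadly_of_mem_BA`,
`mem_BA_of_isBadly`).

If `α` is badly approximable, the forward orbit of `Λ_α` stays in a set `thick ε` of lattices without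
short vectors. This set is closed, and by Mahler's criterion (`precompact_of_subset_thick`) its
subsets are precompact. If the forward orbit accumulates at `L` as time goes to infinity, then every
`diag s • L`, for `s` of either sign, is a limit of points of the forward orbit; so the two-sided
orbit of `L` lies in `thick ε` and is precompact. This is the second half of the theorem.

For the first half, a Cantor set of badly approximable numbers is built inside the limit set.
Intervals of level `n` have length about `b ^ (-2 n)`. At most one fraction with denominator below
`b ^ (n + 1)` is near such an interval, so a positive proportion of its `b ^ 2` pieces can be kept
as children, away from all these fractions (`exists_children`); numbers in all the chosen
intervals are badly approximable. At very sparse steps no choice is offered, and the construction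
descends to a small interval around one number `α = (p θ + p') / (q θ + q')` instead
(`exists_insertion`). Here `p / q` is an approximation of the midpoint of the interval, and `θ` is
the slope of a basis of `L` whose first vector is very long and almost horizontal
(`exists_long_basis`). The orbit of `Λ_α` then meets the stable leaf of `L` in a point close to `L`
(`diag_smul_latticeOf_eq`), and the lower bound for the products `x y` on `L` makes `α` badly
approximable, with a constant that does not depend on how close to `L` the orbit comes
(`min_le_mul_abs_of_smul_eq`). Some further free steps restore the bounds needed for the next
insertion (`FarBelow.succ`), so that all constants are uniform.

Reading off the digits of the free choices maps the Cantor set onto the unit interval. As the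
insertions are sparse and `b` is large, this map is Hölder continuous with exponent close to one,
which bounds the dimension from below (`le_dimH_range`).
-/

namespace LatticeFlow

open scoped NNReal ENNReal

/-! ### Badly approximable numbers -/

/-- `α` is `c`-badly approximable: `q |q α - p| ≥ c` for all integers `p` and all `q ≥ 1`. -/
def IsBadly (c α : ℝ) : Prop := ∀ (p : ℤ) (q : ℕ), 0 < q → c ≤ q * |q * α - p|

open GenContFract in
/-- The continuants of a regular continued fraction are integers. -/
theorem contsAux_of_int (α : ℝ) (n : ℕ) :
    ∃ A B : ℤ, ((GenContFract.of α).contsAux n).a = A ∧ ((GenContFract.of α).contsAux n).b = B := by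
  induction n using Nat.strong_induction_on with
  | _ n ih =>
    match n with
    | 0 => exact ⟨1, 0, by simp [contsAux]⟩
    | 1 => exact ⟨⌊α⌋, 1, by simp [contsAux, of_h_eq_floor]⟩
    | n + 2 =>
      obtain ⟨A1, B1, hA1, hB1⟩ := ih (n + 1) (by omega)
      obtain ⟨A0, B0, hA0, hB0⟩ := ih n (by omega)
      cases h : (GenContFract.of α).s.get? n with
      | none =>
        refine ⟨A1, B1, ?_, ?_⟩
        · rw [contsAux_stable_step_of_terminated h, hA1]
        · rw [contsAux_stable_step_of_terminated h, hB1]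
      | some gp =>
        obtain ⟨ha, z, hz⟩ := of_partNum_eq_one_and_exists_int_partDen_eq h
        refine ⟨z * A1 + A0, z * B1 + B0, ?_, ?_⟩
        · rw [contsAux_recurrence h rfl rfl, ha, hz, hA1, hA0]; push_cast; ring
        · rw [contsAux_recurrence h rfl rfl, ha, hz, hB1, hB0]; push_cast; ring

theorem not_terminatedAt_of_irrational {α : ℝ} (h : Irrational α) (n : ℕ) :
    ¬ (GenContFract.of α).TerminatedAt n := by
  intro ht
  obtain ⟨q, hq⟩ := (GenContFract.terminates_iff_rat α).1 ⟨n, ht⟩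
  exact h ⟨q, hq.symm⟩

open GenContFract in
theorem dens_pos (α : ℝ) (n : ℕ) : 1 ≤ (GenContFract.of α).dens n := by
  induction n with
  | zero => simp
  | succ n ih => exact ih.trans of_den_mono

open GenContFract in
/-- The convergents of an irrational number are fractions in lowest terms. -/
theorem convs_int {α : ℝ} (h : Irrational α) (n : ℕ) :
    ∃ A B : ℤ, (GenContFract.of α).nums n = A ∧ (GenContFract.of α).dens n = B ∧ IsCoprime A B := by
  obtain ⟨A, B, hA, hB⟩ := contsAux_of_int α (n + 1)
  obtain ⟨A', B', hA', hB'⟩ := contsAux_of_int α (n + 2)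
  refine ⟨A, B, hA, hB, ?_⟩
  have hdet := SimpContFract.determinant (s := SimpContFract.of α) (n := n)
    (not_terminatedAt_of_irrational h n)
  change (GenContFract.of α).nums n * (GenContFract.of α).dens (n + 1) -
    (GenContFract.of α).dens n * (GenContFract.of α).nums (n + 1) = _ at hdet
  have e1 : (GenContFract.of α).nums n = A := hA
  have e2 : (GenContFract.of α).dens n = B := hB
  have e3 : (GenContFract.of α).nums (n + 1) = A' := hA'
  have e4 : (GenContFract.of α).dens (n + 1) = B' := hB'
  rw [e1, e2, e3, e4] at hdet
  have hd : A * B' - B * A' = (-1) ^ (n + 1) := by exact_mod_cast hdet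
  refine ⟨(-1) ^ (n + 1) * B', -(-1) ^ (n + 1) * A', ?_⟩
  have : ((-1 : ℤ) ^ (n + 1)) * (-1) ^ (n + 1) = 1 := by
    rw [← mul_pow]; simp
  linear_combination (-1) ^ (n + 1) * hd + this

open GenContFract in
/-- The error of a convergent is `1 / (B (z B + B'))` with consecutive denominators `B' ≤ B` and a
complete quotient `z`, which exceeds the next partial quotient by less than one. -/
theorem abs_sub_convs_ge {α M : ℝ} (h : Irrational α)
    (hM : ∀ (n : ℕ) (b : ℝ), (GenContFract.of α).partDens.get? n = some b → b ≤ M) (n : ℕ) :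
    1 / ((M + 2) * (GenContFract.of α).dens n ^ 2) ≤ |α - (GenContFract.of α).convs n| := by
  have hnt := not_terminatedAt_of_irrational h n
  obtain ⟨b, hb⟩ := Option.ne_none_iff_exists'.1 hnt
  obtain ⟨ifp', hs', hb'⟩ := IntFractPair.exists_succ_get?_stream_of_gcf_of_get?_eq_some hb
  obtain ⟨ifp, hs, hfr, hof⟩ := IntFractPair.succ_nth_stream_eq_some_iff.1 hs'
  have hle : b.b ≤ M := hM n _ (partDen_eq_s_b hb)
  have hfl : ifp.fr⁻¹ < b.b + 1 := by
    rw [← hb', ← hof]; exact Int.lt_floor_add_one _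
  have h0 : 0 < ifp.fr := lt_of_le_of_ne (IntFractPair.nth_stream_fr_nonneg hs) (Ne.symm hfr)
  have hB := dens_pos α n
  have hB0 := zero_le_of_contsAux_b (v := α) (n := n)
  have hBB : ((GenContFract.of α).contsAux n).b ≤ (GenContFract.of α).dens n := by
    cases n with
    | zero => simp [contsAux]
    | succ n => exact of_den_mono
  rw [sub_convs_eq hs, if_neg hfr, abs_div, abs_pow, abs_neg, abs_one, one_pow]
  change 1 / ((M + 2) * (GenContFract.of α).dens n ^ 2) ≤
    1 / |(GenContFract.of α).dens n * (ifp.fr⁻¹ * (GenContFract.of α).dens n + _)|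
  have hi : 0 < ifp.fr⁻¹ := inv_pos.2 h0
  rw [abs_of_pos (by positivity)]
  refine one_div_le_one_div_of_le (by positivity) ?_
  nlinarith [mul_nonneg (by linarith : 0 ≤ M + 1 - ifp.fr⁻¹)
    (sq_nonneg ((GenContFract.of α).dens n))]

theorem coprime_den_eq {r : ℚ} {A B : ℤ} (hB : 0 < B) (h : IsCoprime A B)
    (hr : (r : ℝ) = A / B) : (r.den : ℤ) = B := by
  have h1 : r = (A : ℚ) / B := by exact_mod_cast hr
  rw [h1]
  exact Rat.den_div_eq_of_coprime hB (Int.isCoprime_iff_gcd_eq_one.1 h)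

/-- Bounded partial quotients give a Diophantine lower bound: by Legendre's theorem a very good
rational approximation is a convergent, whose error the next partial quotient controls. -/
theorem exists_isBadly_of_mem_BA {α : ℝ} (h : α ∈ BA) : ∃ c > 0, IsBadly c α := by
  obtain ⟨hi, M, hM⟩ := h
  have hM1 : 1 ≤ M := by
    obtain ⟨b, hb⟩ := Option.ne_none_iff_exists'.1 (not_terminatedAt_of_irrational hi 0)
    have hb' := GenContFract.partDen_eq_s_b hb
    exact (GenContFract.of_one_le_get?_partDen hb').trans (hM 0 _ hb')
  refine ⟨1 / (M + 2), by positivity, fun p q hq => ?_⟩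
  have hq' : (0 : ℝ) < q := by exact_mod_cast hq
  have key : (q : ℝ) * |q * α - p| = q ^ 2 * |α - ((p / q : ℚ) : ℝ)| := by
    have : (q : ℝ) * α - p = q * (α - ((p / q : ℚ) : ℝ)) := by push_cast; field_simp
    rw [this, abs_mul, abs_of_pos hq']; ring
  by_contra hlt
  push Not at hlt
  rw [key] at hlt
  set r : ℚ := p / q with hr
  have hden : (r.den : ℝ) ≤ q := by
    have : r.den ∣ q := by
      have := Rat.den_dvd p q
      rw [Rat.divInt_eq_div, Int.cast_natCast, ← hr] at this
      exact_mod_cast this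
    exact_mod_cast Nat.le_of_dvd hq this
  have hdpos : (0 : ℝ) < r.den := by exact_mod_cast r.den_pos
  have hsq : (r.den : ℝ) ^ 2 ≤ q ^ 2 := by gcongr
  have hlt2 : |α - r| * q ^ 2 < 1 / (M + 2) := by linarith
  obtain ⟨n, hn⟩ := Real.exists_rat_eq_convergent (ξ := α) (q := r) (by
    rw [lt_div_iff₀ (by positivity)]
    have : 1 / (M + 2) ≤ 1 / 2 := one_div_le_one_div_of_le (by norm_num) (by linarith)
    nlinarith [abs_nonneg (α - r)])
  have hc : (GenContFract.of α).convs n = r := by rw [Real.convs_eq_convergent, hn]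
  obtain ⟨A, B, hA, hB, hcop⟩ := convs_int hi n
  have hBpos : 0 < B := by
    have := dens_pos α n
    rw [hB] at this
    exact_mod_cast lt_of_lt_of_le one_pos this
  have hdB : (r.den : ℤ) = B := by
    refine coprime_den_eq hBpos hcop ?_
    rw [← hc, GenContFract.conv_eq_num_div_den, hA, hB]
  have hge := abs_sub_convs_ge hi hM n
  rw [hc, hB, ← hdB] at hge
  push_cast at hge
  have h2 : 1 / ((M + 2) * (r.den : ℝ) ^ 2) * q ^ 2 ≤ |α - r| * q ^ 2 := by gcongr
  have h3 : 1 / (M + 2) ≤ 1 / ((M + 2) * (r.den : ℝ) ^ 2) * q ^ 2 := by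
    rw [div_mul_eq_mul_div, one_mul, div_le_div_iff₀ (by positivity) (by positivity)]
    nlinarith
  linarith

/-- A large partial quotient would make the preceding convergent too good an approximation. -/
theorem mem_BA_of_isBadly {α c : ℝ} (hc : 0 < c) (h : IsBadly c α) : α ∈ BA := by
  have hi : Irrational α := by
    rintro ⟨r, rfl⟩
    have := h r.num r.den r.den_pos
    have e : (r.den : ℝ) * r - r.num = 0 := by
      have := Rat.den_mul_eq_num r
      have h2 : ((r.den * r : ℚ) : ℝ) = ((r.num : ℚ) : ℝ) := by rw [this]
      push_cast at h2; linarith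
    rw [e] at this; simp at this; linarith
  refine ⟨hi, 1 / c, fun n b hb => ?_⟩
  obtain ⟨A, B, hA, hB, -⟩ := convs_int hi n
  have hB1 := dens_pos α n
  have hb1 := GenContFract.of_one_le_get?_partDen hb
  have hnt := not_terminatedAt_of_irrational hi n
  have h1 := GenContFract.abs_sub_convs_le hnt
  have h2 := GenContFract.le_of_succ_get?_den hb
  rw [GenContFract.conv_eq_num_div_den, hA, hB] at h1
  rw [hB] at hB1 h2
  have hBpos : (0 : ℝ) < B := by linarith
  have hBi : 0 < B := by exact_mod_cast hBpos
  have hb3 := h A B.toNat (by omega)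
  have hcast : ((B.toNat : ℕ) : ℝ) = B := by
    have : ((B.toNat : ℕ) : ℤ) = B := Int.toNat_of_nonneg hBi.le
    exact_mod_cast this
  rw [hcast] at hb3
  have e : (B : ℝ) * α - A = B * (α - A / B) := by field_simp
  rw [e, abs_mul, abs_of_pos hBpos] at hb3
  have h4 : 1 / ((B : ℝ) * (GenContFract.of α).dens (n + 1)) ≤ 1 / (B * (b * B)) :=
    one_div_le_one_div_of_le (by positivity) (by gcongr)
  have h5 : c ≤ B * (B * (1 / (B * (b * B)))) :=
    hb3.trans (by gcongr; exact h1.trans h4)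
  have h6 : (B : ℝ) * (B * (1 / (B * (b * B)))) = 1 / b := by field_simp
  rw [h6] at h5
  rw [le_div_iff₀ hc]
  rw [le_div_iff₀ (by linarith)] at h5
  linarith

/-! ### Bases of lattices -/

/-- The lattice vector with integer coordinates `(m, n)` in the basis given by the columns
of `g`. -/
def vec (g : G) (m n : ℤ) : Fin 2 → ℝ :=
  ![g 0 0 * m + g 0 1 * n, g 1 0 * m + g 1 1 * n]

@[simp] theorem vec_zero (g : G) (m n : ℤ) : vec g m n 0 = g 0 0 * m + g 0 1 * n := rfl
@[simp] theorem vec_one (g : G) (m n : ℤ) : vec g m n 1 = g 1 0 * m + g 1 1 * n := rfl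

theorem det_eq (g : G) : g 0 0 * g 1 1 - g 0 1 * g 1 0 = 1 := by
  rw [← Matrix.det_fin_two, g.2]

theorem mem_toLattice {g : G} {v : Fin 2 → ℝ} :
    v ∈ (toLattice g).1 ↔ ∃ m n : ℤ, v = vec g m n := by
  constructor
  · rintro ⟨w, ⟨z, rfl⟩, rfl⟩
    refine ⟨z 0, z 1, ?_⟩
    ext i
    fin_cases i <;> simp [linAct_apply, Matrix.mulVec, dotProduct, Fin.sum_univ_two]
  · rintro ⟨m, n, rfl⟩
    refine ⟨fun i => ((![m, n] : Fin 2 → ℤ) i : ℝ), ⟨![m, n], rfl⟩, ?_⟩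
    ext i
    fin_cases i <;> simp [linAct_apply, Matrix.mulVec, dotProduct, Fin.sum_univ_two]

theorem vec_mem (g : G) (m n : ℤ) : vec g m n ∈ (toLattice g).1 := mem_toLattice.2 ⟨m, n, rfl⟩

theorem exists_toLattice (L : X) : ∃ g, L = toLattice g := by
  obtain ⟨g, hg⟩ := L.2
  exact ⟨g, Subtype.ext hg⟩

theorem smul_toLattice (g h : G) : g • toLattice h = toLattice (g * h) := by
  refine Subtype.ext ?_
  change (intLattice.map (linAct h)).map (linAct g) = intLattice.map (linAct (g * h))
  rw [AddSubgroup.map_map, linAct_mul]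

theorem vec_eq_zero_iff (g : G) (m n : ℤ) : vec g m n = 0 ↔ m = 0 ∧ n = 0 := by
  constructor
  · intro h
    have h0 := congrFun h 0
    have h1 := congrFun h 1
    simp only [vec_zero, vec_one, Pi.zero_apply] at h0 h1
    have hd := det_eq g
    constructor
    · have : (m : ℝ) = 0 := by linear_combination g 1 1 * h0 - g 0 1 * h1 - m * hd
      exact_mod_cast this
    · have : (n : ℝ) = 0 := by linear_combination g 0 0 * h1 - g 1 0 * h0 - n * hd
      exact_mod_cast this
  · rintro ⟨rfl, rfl⟩
    ext i
    fin_cases i <;> simp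

/-- An integral matrix of determinant one, as an element of `SL₂(ℝ)`. -/
def intMat (a b c d : ℤ) (h : a * d - b * c = 1) : G :=
  ⟨!![(a : ℝ), b; c, d], by rw [Matrix.det_fin_two_of]; exact_mod_cast h⟩

theorem mul_apply_two (g h : G) (i j : Fin 2) :
    (g * h) i j = g i 0 * h 0 j + g i 1 * h 1 j := by
  rw [Matrix.SpecialLinearGroup.coe_mul, Matrix.mul_apply, Fin.sum_univ_two]

theorem mul_intMat_zero (g : G) (a b c d : ℤ) (h : a * d - b * c = 1) (i : Fin 2) :
    (g * intMat a b c d h) i 0 = g i 0 * a + g i 1 * c := mul_apply_two g _ i 0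

theorem mul_intMat_one (g : G) (a b c d : ℤ) (h : a * d - b * c = 1) (i : Fin 2) :
    (g * intMat a b c d h) i 1 = g i 0 * b + g i 1 * d := mul_apply_two g _ i 1

theorem vec_mul_intMat (g : G) (a b c d : ℤ) (h : a * d - b * c = 1) (m n : ℤ) :
    vec (g * intMat a b c d h) m n = vec g (a * m + b * n) (c * m + d * n) := by
  ext i
  fin_cases i <;> simp [mul_intMat_zero, mul_intMat_one] <;> ring

/-- Changing the basis by an element of `SL₂(ℤ)` does not change the lattice. -/
theorem toLattice_mul_intMat (g : G) (a b c d : ℤ) (h : a * d - b * c = 1) :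
    toLattice (g * intMat a b c d h) = toLattice g := by
  refine Subtype.ext (AddSubgroup.ext fun v => ?_)
  rw [mem_toLattice, mem_toLattice]
  constructor
  · rintro ⟨m, n, rfl⟩
    exact ⟨_, _, vec_mul_intMat ..⟩
  · rintro ⟨m, n, rfl⟩
    refine ⟨d * m - b * n, a * n - c * m, ?_⟩
    rw [vec_mul_intMat]
    congr 1
    · linear_combination -m * h
    · linear_combination -n * h

/-! ### The space of lattices -/

theorem continuous_toLattice : Continuous toLattice := continuous_coinduced_rng

theorem isOpen_iff_preimage {S : Set X} : IsOpen S ↔ IsOpen (toLattice ⁻¹' S) := isOpen_coinduced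

theorem isClosed_iff_preimage {S : Set X} : IsClosed S ↔ IsClosed (toLattice ⁻¹' S) :=
  isClosed_coinduced

theorem continuous_entry (i j : Fin 2) : Continuous fun g : G => g i j :=
  (continuous_apply_apply i j).comp continuous_subtype_val

theorem continuous_smul_left (L : X) : Continuous fun g : G => g • L := by
  obtain ⟨h, rfl⟩ := exists_toLattice L
  simp only [smul_toLattice]
  exact continuous_toLattice.comp (continuous_mul_const h)

theorem continuous_smul_right (g : G) : Continuous fun L : X => g • L := by
  refine continuous_coinduced_dom.2 ?_
  change Continuous fun h : G => g • toLattice h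
  simp only [smul_toLattice]
  exact continuous_toLattice.comp (continuous_const_mul g)

/-- The lattices all of whose nonzero vectors have sup norm at least `ε`. -/
def thick (ε : ℝ) : Set X := {L | ∀ v ∈ L.1, v ≠ 0 → ε ≤ ‖v‖}

theorem toLattice_mem_thick {ε : ℝ} {g : G} :
    toLattice g ∈ thick ε ↔ ∀ m n : ℤ, ¬ (m = 0 ∧ n = 0) → ε ≤ ‖vec g m n‖ := by
  constructor
  · intro h m n hmn
    exact h _ (vec_mem g m n) (by rwa [Ne, vec_eq_zero_iff])
  · intro h v hv h0
    obtain ⟨m, n, rfl⟩ := mem_toLattice.1 hv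
    exact h m n (by rwa [Ne, vec_eq_zero_iff] at h0)

theorem isClosed_thick (ε : ℝ) : IsClosed (thick ε) := by
  rw [isClosed_iff_preimage]
  have : toLattice ⁻¹' thick ε =
      ⋂ (m : ℤ) (n : ℤ) (_ : ¬ (m = 0 ∧ n = 0)), {g | ε ≤ ‖vec g m n‖} := by
    ext g
    simp only [Set.mem_preimage, toLattice_mem_thick, Set.mem_iInter, Set.mem_ofPred_eq]
  rw [this]
  refine isClosed_iInter fun m => isClosed_iInter fun n => isClosed_iInter fun _ =>
    isClosed_le continuous_const (continuous_norm.comp ?_)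
  refine continuous_pi fun i => ?_
  fin_cases i
  · exact ((continuous_entry 0 0).mul continuous_const).add
      ((continuous_entry 0 1).mul continuous_const)
  · exact ((continuous_entry 1 0).mul continuous_const).add
      ((continuous_entry 1 1).mul continuous_const)

theorem norm_le_iff_two {v : Fin 2 → ℝ} {r : ℝ} (hr : 0 ≤ r) :
    ‖v‖ ≤ r ↔ |v 0| ≤ r ∧ |v 1| ≤ r := by
  rw [pi_norm_le_iff_of_nonneg hr, Fin.forall_fin_two]; rfl

theorem abs_le_norm (v : Fin 2 → ℝ) (i : Fin 2) : |v i| ≤ ‖v‖ := norm_le_pi_norm v i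

/-- The operator norm of a matrix with respect to the sup norm: the largest row sum. -/
def rowNorm (g : G) : ℝ := max (|g 0 0| + |g 0 1|) (|g 1 0| + |g 1 1|)

theorem continuous_rowNorm : Continuous rowNorm :=
  ((continuous_entry 0 0).abs.add (continuous_entry 0 1).abs).max
    ((continuous_entry 1 0).abs.add (continuous_entry 1 1).abs)

theorem rowNorm_nonneg (g : G) : 0 ≤ rowNorm g := le_max_of_le_left (by positivity)

theorem rowNorm_one : rowNorm 1 = 1 := by simp [rowNorm]

theorem norm_vec_mul_le (g h : G) (m n : ℤ) :
    ‖vec (g * h) m n‖ ≤ rowNorm g * ‖vec h m n‖ := by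
  have key : ∀ i, |vec (g * h) m n i| ≤ (|g i 0| + |g i 1|) * ‖vec h m n‖ := fun i => by
    have : vec (g * h) m n i = g i 0 * vec h m n 0 + g i 1 * vec h m n 1 := by
      fin_cases i <;> simp [mul_apply_two] <;> ring
    rw [this, add_mul]
    refine (abs_add_le _ _).trans ?_
    rw [abs_mul, abs_mul]
    gcongr <;> exact abs_le_norm _ _
  rw [norm_le_iff_two (mul_nonneg (rowNorm_nonneg g) (norm_nonneg _))]
  exact ⟨(key 0).trans (by gcongr; exact le_max_left _ _),
    (key 1).trans (by gcongr; exact le_max_right _ _)⟩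

/-- Integer vectors have norm at least one, so the norm of `g⁻¹` bounds the nonzero vectors of `g ℤ²`
from below. -/
theorem exists_mem_thick (g : G) : ∃ ε > 0, toLattice g ∈ thick ε := by
  have hg : 0 < rowNorm g⁻¹ := by
    refine lt_of_le_of_ne (rowNorm_nonneg _) fun h => ?_
    have h2 := norm_vec_mul_le g⁻¹ g 1 0
    rw [← h, zero_mul, inv_mul_cancel, norm_le_zero_iff, vec_eq_zero_iff] at h2
    exact one_ne_zero h2.1
  refine ⟨1 / rowNorm g⁻¹, by positivity, toLattice_mem_thick.2 fun m n hmn => ?_⟩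
  have h2 := norm_vec_mul_le g⁻¹ g m n
  rw [inv_mul_cancel] at h2
  rw [div_le_iff₀ hg, mul_comm]
  refine le_trans ?_ h2
  have h0 := abs_le_norm (vec 1 m n) 0
  have h1 := abs_le_norm (vec 1 m n) 1
  simp at h0 h1
  by_cases hm : m = 0
  · have hn : n ≠ 0 := fun hn => hmn ⟨hm, hn⟩
    refine le_trans ?_ h1
    exact_mod_cast Int.one_le_abs hn
  · refine le_trans ?_ h0
    exact_mod_cast Int.one_le_abs hm

/-- Lattices close to one in `thick ε` lie in `thick δ'` for any prescribed `δ' < ε`. A single set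
`thick ε` need not be open, which is why the union appears. -/
theorem isOpen_iUnion_thick (δ : ℝ) : IsOpen (⋃ ε > δ, thick ε) := by
  rw [isOpen_iff_preimage, isOpen_iff_mem_nhds]
  intro g hg
  simp only [Set.mem_preimage, Set.mem_iUnion, exists_prop] at hg
  obtain ⟨ε, hε, hg⟩ := hg
  obtain ⟨δ', h1, h2⟩ := exists_between hε
  have hc : Continuous fun g' : G => rowNorm (g * g'⁻¹) * δ' :=
    (continuous_rowNorm.comp (continuous_const.mul continuous_inv)).mul continuous_const
  have hev : ∀ᶠ g' in 𝓝 g, rowNorm (g * g'⁻¹) * δ' < ε := by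
    refine hc.continuousAt.eventually_lt continuousAt_const ?_
    simpa [rowNorm_one] using h2
  filter_upwards [hev] with g' hg'
  simp only [Set.mem_preimage, Set.mem_iUnion, exists_prop]
  refine ⟨δ', h1, toLattice_mem_thick.2 fun m n hmn => ?_⟩
  by_contra hlt
  push Not at hlt
  have h3 := toLattice_mem_thick.1 hg m n hmn
  have h4 := norm_vec_mul_le (g * g'⁻¹) g' m n
  rw [inv_mul_cancel_right] at h4
  have h5 := mul_le_mul_of_nonneg_left hlt.le (rowNorm_nonneg (g * g'⁻¹))
  linarith

/-- Precompact sets of lattices have uniformly long nonzero vectors. -/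
theorem Precompact.exists_subset_thick {S : Set X} (hS : Precompact S) :
    ∃ ε > 0, S ⊆ thick ε := by
  have : ∃ ε > 0, closure S ⊆ thick ε := by
    refine IsCompact.induction_on (p := fun T => ∃ ε > 0, T ⊆ thick ε) hS
      ⟨1, one_pos, Set.empty_subset _⟩ ?_ ?_ ?_
    · rintro s t hst ⟨ε, hε, h⟩
      exact ⟨ε, hε, hst.trans h⟩
    · rintro s t ⟨ε, hε, h⟩ ⟨ε', hε', h'⟩
      refine ⟨min ε ε', lt_min hε hε', Set.union_subset ?_ ?_⟩
      · exact fun L hL v hv h0 => (min_le_left _ _).trans (h hL v hv h0)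
      · exact fun L hL v hv h0 => (min_le_right _ _).trans (h' hL v hv h0)
    · intro L _
      obtain ⟨g, rfl⟩ := exists_toLattice L
      obtain ⟨ε, hε, hg⟩ := exists_mem_thick g
      refine ⟨⋃ ε' > ε / 2, thick ε', mem_nhdsWithin_of_mem_nhds
        ((isOpen_iUnion_thick _).mem_nhds ?_), ε / 2, by positivity, ?_⟩
      · simp only [Set.mem_iUnion, exists_prop]
        exact ⟨ε, by linarith, hg⟩
      · intro L hL v hv h0
        simp only [Set.mem_iUnion, exists_prop] at hL
        obtain ⟨ε', h1, h2⟩ := hL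
        exact h1.le.trans (h2 v hv h0)
  obtain ⟨ε, hε, h⟩ := this
  exact ⟨ε, hε, subset_closure.trans h⟩

theorem isCompact_bounded_entries (C : ℝ) : IsCompact {g : G | ∀ i j, |g i j| ≤ C} := by
  have hcl : IsClosed {A : Matrix (Fin 2) (Fin 2) ℝ | A.det = 1} :=
    isClosed_eq (continuous_id.matrix_det) continuous_const
  have hemb : Topology.IsClosedEmbedding fun g : G => (g : Matrix (Fin 2) (Fin 2) ℝ) :=
    hcl.isClosedEmbedding_subtypeVal
  have hK : IsCompact (Set.pi Set.univ fun _ : Fin 2 => Set.pi Set.univ fun _ : Fin 2 =>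
      Set.Icc (-C) C) := isCompact_univ_pi fun _ => isCompact_univ_pi fun _ => isCompact_Icc
  have := hemb.isCompact_preimage hK
  convert! this using 1
  ext g
  exact ⟨fun h i _ j _ => abs_le.1 (h i j), fun h i j => abs_le.2 (h i trivial j trivial)⟩

theorem sq_norm_le_two (v : Fin 2 → ℝ) : ‖v‖ ^ 2 ≤ v 0 ^ 2 + v 1 ^ 2 := by
  have : ‖v‖ ≤ √(v 0 ^ 2 + v 1 ^ 2) := by
    rw [norm_le_iff_two (Real.sqrt_nonneg _)]
    exact ⟨Real.abs_le_sqrt (by nlinarith [sq_nonneg (v 1)]),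
      Real.abs_le_sqrt (by nlinarith [sq_nonneg (v 0)])⟩
  calc ‖v‖ ^ 2 ≤ √(v 0 ^ 2 + v 1 ^ 2) ^ 2 := by gcongr
    _ = _ := Real.sq_sqrt (by positivity)

/-- Reduction theory: a lattice without short vectors has a basis of bounded size. The first basis
vector is chosen almost as short as possible, and the second one is reduced modulo the first. -/
theorem exists_reduced_basis {ε : ℝ} (hε : 0 < ε) {L : X} (hL : L ∈ thick ε) :
    ∃ g : G, toLattice g = L ∧ ∀ i j, |g i j| ≤ 2 + 1 / ε := by
  have col_ge : ∀ g : G, toLattice g = L → ε ^ 2 ≤ g 0 0 ^ 2 + g 1 0 ^ 2 := by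
    rintro g rfl
    have h1 := toLattice_mem_thick.1 hL 1 0 (by simp)
    have h2 := sq_norm_le_two (vec g 1 0)
    simp only [vec_zero, vec_one, Int.cast_one, Int.cast_zero, mul_one, mul_zero, add_zero] at h2
    exact le_trans (by gcongr) h2
  set S : Set ℝ := {s | ∃ g : G, toLattice g = L ∧ g 0 0 ^ 2 + g 1 0 ^ 2 = s} with hS
  have hne : S.Nonempty := by
    obtain ⟨g, hg⟩ := exists_toLattice L
    exact ⟨_, g, hg.symm, rfl⟩
  have hbdd : BddBelow S := by
    refine ⟨ε ^ 2, ?_⟩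
    rintro s ⟨g, hg, rfl⟩
    exact col_ge g hg
  have hd : ε ^ 2 ≤ sInf S := by
    refine le_csInf hne ?_
    rintro s ⟨g, hg, rfl⟩
    exact col_ge g hg
  have hd0 : 0 < sInf S := lt_of_lt_of_le (by positivity) hd
  obtain ⟨s, ⟨g, hg, hgs⟩, hs⟩ := exists_lt_of_csInf_lt hne
    (show sInf S < 3 / 2 * sInf S by linarith)
  have hsd : sInf S ≤ s := csInf_le hbdd ⟨g, hg, hgs⟩
  have hs0 : 0 < s := by linarith
  set t : ℝ := g 0 1 * g 0 0 + g 1 1 * g 1 0 with ht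
  set k : ℤ := round (t / s) with hk
  set g' : G := g * intMat 1 (-k) 0 1 (by ring) with hg'
  have hL' : toLattice g' = L := by rw [hg', toLattice_mul_intMat, hg]
  have e0 : ∀ i, g' i 0 = g i 0 := fun i => by rw [hg', mul_intMat_zero]; push_cast; ring
  have e1 : ∀ i, g' i 1 = g i 1 - k * g i 0 := fun i => by
    rw [hg', mul_intMat_one]; push_cast; ring
  have hs' : g' 0 0 ^ 2 + g' 1 0 ^ 2 = s := by rw [e0, e0, hgs]
  have hip : |g' 0 1 * g' 0 0 + g' 1 1 * g' 1 0| ≤ s / 2 := by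
    have h1 : g' 0 1 * g' 0 0 + g' 1 1 * g' 1 0 = s * (t / s - k) := by
      rw [mul_sub, mul_div_cancel₀ _ hs0.ne', e0, e0, e1, e1, ht]
      linear_combination (-k : ℝ) * hgs
    rw [h1, abs_mul, abs_of_pos hs0]
    have := abs_sub_round (t / s)
    nlinarith
  set w : ℝ := g' 0 1 ^ 2 + g' 1 1 ^ 2 with hw
  have hlag : w * s = (g' 0 1 * g' 0 0 + g' 1 1 * g' 1 0) ^ 2 + 1 := by
    rw [hw, ← hs']
    linear_combination (g' 0 0 * g' 1 1 - g' 0 1 * g' 1 0 + 1) * det_eq g'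
  have hws : w * s ≤ s ^ 2 / 4 + 1 := by
    rw [hlag]
    have := sq_le_sq' (by linarith [abs_le.1 hip]) (abs_le.1 hip).2
    linarith
  have hwd : sInf S ≤ w := by
    refine csInf_le hbdd ⟨g' * intMat 0 (-1) 1 0 (by ring), ?_, ?_⟩
    · rw [toLattice_mul_intMat, hL']
    · rw [mul_intMat_zero _ _ _ _ _ _ 0, mul_intMat_zero _ _ _ _ _ _ 1, hw]; push_cast; ring
  have hs2 : s ≤ 2 := by
    by_contra h
    push Not at h
    nlinarith
  have hεs : ε ^ 2 ≤ s := hd.trans hsd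
  have hw2 : w ≤ 1 / 2 + 1 / ε ^ 2 := by
    have : w ≤ s / 4 + 1 / s := by
      have e : s / 4 + 1 / s = (s ^ 2 / 4 + 1) / s := by field_simp
      rwa [e, le_div_iff₀ hs0]
    have h2 : 1 / s ≤ 1 / ε ^ 2 := one_div_le_one_div_of_le (by positivity) hεs
    linarith
  have hbig : 1 / 2 + 1 / ε ^ 2 ≤ (2 + 1 / ε) ^ 2 := by
    have : 1 / ε ^ 2 = (1 / ε) ^ 2 := by rw [div_pow, one_pow]
    have : 0 < 1 / ε := by positivity
    nlinarith
  have hbig' : 2 ≤ (2 + 1 / ε) ^ 2 := by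
    have : 0 < 1 / ε := by positivity
    nlinarith
  have hC : 0 ≤ 2 + 1 / ε := by positivity
  have key : ∀ x y z : ℝ, x ^ 2 + y ^ 2 = z → z ≤ (2 + 1 / ε) ^ 2 →
      |x| ≤ 2 + 1 / ε ∧ |y| ≤ 2 + 1 / ε := fun x y z h1 h2 =>
    ⟨abs_le_of_sq_le_sq (by nlinarith [sq_nonneg y]) hC,
      abs_le_of_sq_le_sq (by nlinarith [sq_nonneg x]) hC⟩
  have k0 := key _ _ s hs' (hs2.trans hbig')
  have k1 := key _ _ w hw.symm (hw2.trans hbig)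
  exact ⟨g', hL', Fin.forall_fin_two.2 ⟨Fin.forall_fin_two.2 ⟨k0.1, k1.1⟩,
    Fin.forall_fin_two.2 ⟨k0.2, k1.2⟩⟩⟩

/-- Mahler's compactness criterion, in the direction that produces compactness. -/
theorem precompact_of_subset_thick {ε : ℝ} (hε : 0 < ε) {S : Set X} (hS : S ⊆ thick ε) :
    Precompact S := by
  refine ((isCompact_bounded_entries (2 + 1 / ε)).image
    continuous_toLattice).of_isClosed_subset isClosed_closure ?_
  intro L hL
  obtain ⟨g, hg, hb⟩ := exists_reduced_basis hε ((isClosed_thick ε).closure_subset_iff.2 hS hL)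
  exact ⟨g, hb, hg⟩

/-! ### Orbits of the diagonal flow -/

theorem diag_entries (t : ℝ) : diag t 0 0 = Real.exp t ∧ diag t 0 1 = 0 ∧ diag t 1 0 = 0 ∧
    diag t 1 1 = Real.exp (-t) := ⟨rfl, rfl, rfl, rfl⟩

theorem diag_add (s t : ℝ) : diag (s + t) = diag s * diag t := by
  refine Subtype.ext (Matrix.ext fun i j => ?_)
  change diag (s + t) i j = (diag s * diag t) i j
  rw [mul_apply_two]
  fin_cases i <;> fin_cases j <;> simp [diag_entries, Real.exp_add, mul_comm]

theorem vec_diag_mul (t : ℝ) (g : G) (m n : ℤ) :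
    vec (diag t * g) m n = ![Real.exp t * vec g m n 0, Real.exp (-t) * vec g m n 1] := by
  ext i
  fin_cases i <;> simp [mul_apply_two, diag_entries] <;> ring

theorem vec_unip (α : ℝ) (m n : ℤ) : vec (unip α) m n = ![m + α * n, n] := by
  ext i
  fin_cases i
  · simp [show unip α 0 0 = 1 from rfl, show unip α 0 1 = α from rfl]
  · simp [show unip α 1 0 = 0 from rfl, show unip α 1 1 = 1 from rfl]

/-- The coordinate products of the nonzero vectors of a lattice with a precompact orbit are bounded
away from zero: otherwise a suitable `diag t` would make some vector short. -/
theorem exists_le_abs_mul_of_precompact {g : G}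
    (h : Precompact (orbit Set.univ (toLattice g))) :
    ∃ c > 0, ∀ m n : ℤ, ¬ (m = 0 ∧ n = 0) → c ≤ |vec g m n 0 * vec g m n 1| := by
  obtain ⟨ε, hε, hsub⟩ := h.exists_subset_thick
  refine ⟨ε ^ 2 / 2, by positivity, fun m n hmn => ?_⟩
  have hall : ∀ t : ℝ, ε ^ 2 ≤
      (Real.exp t * vec g m n 0) ^ 2 + (Real.exp (-t) * vec g m n 1) ^ 2 := fun t => by
    have h1 : diag t • toLattice g ∈ thick ε := hsub ⟨t, trivial, rfl⟩
    rw [smul_toLattice, toLattice_mem_thick] at h1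
    have h2 := h1 m n hmn
    have h3 := sq_norm_le_two (vec (diag t * g) m n)
    rw [vec_diag_mul] at h2 h3
    simp only [Matrix.cons_val_zero, Matrix.cons_val_one] at h3
    exact le_trans (by gcongr) h3
  generalize vec g m n 0 = x at *
  generalize vec g m n 1 = y at *
  -- a vector on a coordinate axis is contracted to zero in one of the time directions
  have hsmall : ∀ z : ℝ, ∃ t : ℝ, (Real.exp t * z) ^ 2 < ε ^ 2 := fun z => by
    have ht : Filter.Tendsto (fun t => (Real.exp t * z) ^ 2) Filter.atBot (𝓝 ((0 * z) ^ 2)) :=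
      (Real.tendsto_exp_atBot.mul_const z).pow 2
    rw [zero_mul, zero_pow two_ne_zero] at ht
    exact (ht.eventually_lt_const (by positivity)).exists
  have hx : x ≠ 0 := by
    rintro rfl
    obtain ⟨t, ht⟩ := hsmall y
    have := hall (-t)
    rw [neg_neg] at this
    nlinarith
  have hy : y ≠ 0 := by
    rintro rfl
    obtain ⟨t, ht⟩ := hsmall x
    have := hall t
    nlinarith
  have hx' := abs_pos.2 hx
  have hy' := abs_pos.2 hy
  -- the time at which both coordinates have the same absolute value
  have h1 := hall ((Real.log |y| - Real.log |x|) / 2)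
  set t := (Real.log |y| - Real.log |x|) / 2 with ht
  have e1 : Real.exp t ^ 2 = |y| / |x| := by
    rw [← Real.exp_nat_mul, ht, ← Real.exp_log (div_pos hy' hx'), Real.log_div hy'.ne' hx'.ne']
    congr 1; push_cast; ring
  have e2 : Real.exp (-t) ^ 2 = |x| / |y| := by
    rw [← Real.exp_nat_mul, ht, ← Real.exp_log (div_pos hx' hy'), Real.log_div hx'.ne' hy'.ne']
    congr 1; push_cast; ring
  rw [mul_pow, mul_pow, e1, e2, ← sq_abs x, ← sq_abs y] at h1
  have e3 : |y| / |x| * |x| ^ 2 + |x| / |y| * |y| ^ 2 = 2 * |x * y| := by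
    rw [abs_mul]; field_simp; ring
  linarith

/-- The forward orbit of the lattice of a badly approximable number is uniformly thick. -/
theorem smul_latticeOf_mem_thick {c α : ℝ} (h : IsBadly c α) {t : ℝ} (ht : 0 ≤ t) :
    diag t • latticeOf α ∈ thick (min 1 c) := by
  rw [latticeOf, smul_toLattice, toLattice_mem_thick]
  intro m n hmn
  set v := vec (diag t * unip α) m n with hv
  have h0 : v 0 = Real.exp t * (m + α * n) := by rw [hv, vec_diag_mul, vec_unip]; rfl
  have h1 : v 1 = Real.exp (-t) * n := by rw [hv, vec_diag_mul, vec_unip]; rfl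
  by_cases hn : n = 0
  · have hm : m ≠ 0 := fun hm => hmn ⟨hm, hn⟩
    refine (min_le_left _ _).trans (le_trans ?_ (abs_le_norm v 0))
    have h2 : (1 : ℝ) ≤ |(m : ℝ)| := by exact_mod_cast Int.one_le_abs hm
    rw [h0, hn, abs_mul, Real.abs_exp]
    simp only [Int.cast_zero, mul_zero, add_zero]
    nlinarith [Real.one_le_exp ht]
  · have hprod : c ≤ |v 0| * |v 1| := by
      have e : |v 0| * |v 1| = |(n : ℝ)| * |n * α + m| := by
        rw [h0, h1, abs_mul, abs_mul, Real.abs_exp, Real.abs_exp, Real.exp_neg,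
          mul_comm (n : ℝ) α, add_comm (α * n)]
        field_simp
      rw [e]
      have hpos : 0 < n.natAbs := Int.natAbs_pos.2 hn
      rcases Int.natAbs_eq n with hh | hh
      · have := h (-m) n.natAbs hpos
        have e2 : ((n.natAbs : ℕ) : ℝ) = n := by
          rw [Nat.cast_natAbs, abs_of_nonneg (by omega)]
        rw [e2] at this
        have hnn : (0 : ℝ) ≤ n := by rw [← e2]; positivity
        rw [abs_of_nonneg hnn]
        simpa using this
      · have := h m n.natAbs hpos
        have e2 : ((n.natAbs : ℕ) : ℝ) = -n := by
          rw [Nat.cast_natAbs, abs_of_nonpos (by omega), Int.cast_neg]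
        rw [e2] at this
        have hnn : (n : ℝ) ≤ 0 := by
          have : (0 : ℝ) ≤ ((n.natAbs : ℕ) : ℝ) := by positivity
          linarith
        rw [abs_of_nonpos hnn]
        have e3 : -(n : ℝ) * α - m = -(n * α + m) := by ring
        rwa [e3, abs_neg] at this
    by_contra hlt
    push Not at hlt
    have hc1 := lt_of_lt_of_le hlt (min_le_left 1 c)
    have hc2 := lt_of_lt_of_le hlt (min_le_right 1 c)
    have a0 := abs_le_norm v 0
    have a1 := abs_le_norm v 1
    have := mul_le_mul a0 a1 (abs_nonneg _) (norm_nonneg _)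
    nlinarith [norm_nonneg v]

/-- If `L` is a limit point of a thick forward orbit as time goes to infinity, then the whole orbit
of `L`, in both time directions, is thick. -/
theorem orbit_subset_thick_of_frequently {L K : X} {ε : ℝ}
    (hK : ∀ t : ℝ, 0 ≤ t → diag t • K ∈ thick ε)
    (h : ∀ t₀ : ℝ, 0 < t₀ → ∀ U ∈ 𝓝 L, (orbit (Set.Ioi t₀) K ∩ U).Nonempty) :
    orbit Set.univ L ⊆ thick ε := by
  rintro _ ⟨s, -, rfl⟩
  refine (isClosed_thick ε).closure_subset (mem_closure_iff_nhds.2 fun V hV => ?_)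
  have hU := (continuous_smul_right (diag s)).continuousAt.preimage_mem_nhds hV
  obtain ⟨_, ⟨t, ht, rfl⟩, hmem⟩ := h (max 1 (-s)) (by positivity) _ hU
  refine ⟨diag s • diag t • K, hmem, ?_⟩
  rw [← mul_smul, ← diag_add]
  refine hK _ ?_
  have : max 1 (-s) < t := ht
  have := le_max_right 1 (-s)
  linarith

theorem exists_disjoint_nhds_of_not_precompact {L : X} (hL : ¬ Precompact (orbit Set.univ L))
    {α : ℝ} (hα : α ∈ BA) : ∃ t₀ : ℝ, 0 < t₀ ∧ ∃ U ∈ 𝓝 L,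
      orbit (Set.Ioi t₀) (latticeOf α) ∩ U = ∅ := by
  obtain ⟨c, hc, h⟩ := exists_isBadly_of_mem_BA hα
  by_contra hcon
  push Not at hcon
  exact hL (precompact_of_subset_thick (lt_min one_pos hc) (orbit_subset_thick_of_frequently
    (fun t ht => smul_latticeOf_mem_thick h ht) hcon))

/-! ### Numbers whose forward orbit passes close to a given lattice -/

/-- The unipotent matrix with rows `(1, 0)` and `(r, 1)`; it is contracted by the forward flow. -/
def low (r : ℝ) : G := ⟨!![1, 0; r, 1], by simp [Matrix.det_fin_two]⟩

theorem low_entries (r : ℝ) : low r 0 0 = 1 ∧ low r 0 1 = 0 ∧ low r 1 0 = r ∧ low r 1 1 = 1 :=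
  ⟨rfl, rfl, rfl, rfl⟩

theorem unip_entries (x : ℝ) :
    unip x 0 0 = 1 ∧ unip x 0 1 = x ∧ unip x 1 0 = 0 ∧ unip x 1 1 = 1 := ⟨rfl, rfl, rfl, rfl⟩

theorem ext_entries {g h : G} (h00 : g 0 0 = h 0 0) (h01 : g 0 1 = h 0 1) (h10 : g 1 0 = h 1 0)
    (h11 : g 1 1 = h 1 1) : g = h := by
  refine Subtype.ext (Matrix.ext fun i j => ?_)
  fin_cases i <;> fin_cases j
  exacts [h00, h01, h10, h11]

theorem diag_mul_unip (t x : ℝ) :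
    diag t * unip x = unip (Real.exp t ^ 2 * x) * diag t := by
  have e : Real.exp t * Real.exp (-t) = 1 := by rw [← Real.exp_add]; simp
  refine ext_entries ?_ ?_ ?_ ?_ <;> rw [mul_apply_two, mul_apply_two] <;>
    simp only [diag_entries, unip_entries]
  · ring
  · linear_combination -(Real.exp t * x) * e
  · ring
  · ring

theorem unip_add (x y : ℝ) : unip (x + y) = unip x * unip y := by
  refine ext_entries ?_ ?_ ?_ ?_ <;> rw [mul_apply_two] <;> simp only [unip_entries] <;> ring

theorem vec_low_mul (r : ℝ) (g : G) (m n : ℤ) :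
    vec (low r * g) m n = ![vec g m n 0, vec g m n 1 + r * vec g m n 0] := by
  ext i
  fin_cases i <;> simp [mul_apply_two, low_entries]; ring

/-- Some forward translate of the lattice of `α` is `δ`-close to `L`. -/
def Hits (L : X) (δ α : ℝ) : Prop := ∃ t > 0, ∃ s r : ℝ, |s| ≤ δ ∧ |r| ≤ δ ∧
  diag t • latticeOf α = (unip s * low r) • L

theorem Hits.mono {L : X} {δ δ' α : ℝ} (h : Hits L δ α) (hδ : δ ≤ δ') : Hits L δ' α := by
  obtain ⟨t, ht, s, r, hs, hr, e⟩ := h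
  exact ⟨t, ht, s, r, hs.trans hδ, hr.trans hδ, e⟩

theorem continuous_of_entries {Y : Type*} [TopologicalSpace Y] {f : Y → G}
    (h : ∀ i j, Continuous fun y => f y i j) : Continuous f :=
  continuous_induced_rng.2 (continuous_matrix h)

theorem continuous_unip : Continuous unip := by
  refine continuous_of_entries fun i j => ?_
  fin_cases i <;> fin_cases j
  exacts [continuous_const, continuous_id, continuous_const, continuous_const]

theorem continuous_low : Continuous low := by
  refine continuous_of_entries fun i j => ?_
  fin_cases i <;> fin_cases j
  exacts [continuous_const, continuous_const, continuous_id, continuous_const]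

theorem unip_zero_mul_low_zero : unip 0 * low 0 = 1 := by
  refine ext_entries ?_ ?_ ?_ ?_ <;> rw [mul_apply_two] <;> simp [low_entries, unip_entries]

theorem continuous_unip_mul_low_smul (L : X) :
    Continuous fun x : ℝ × ℝ => (unip x.1 * low x.2) • L :=
  (continuous_smul_left L).comp
    ((continuous_unip.comp continuous_fst).mul (continuous_low.comp continuous_snd))

theorem exists_forall_smul_mem_of_mem_nhds {L : X} {V : Set X} (hV : V ∈ 𝓝 L) :
    ∃ δ > 0, ∀ s r : ℝ, |s| ≤ δ → |r| ≤ δ → (unip s * low r) • L ∈ V := by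
  have h0 : Filter.Tendsto (fun x : ℝ × ℝ => (unip x.1 * low x.2) • L) (𝓝 ((0 : ℝ), (0 : ℝ)))
      (𝓝 L) := by
    have := (continuous_unip_mul_low_smul L).tendsto ((0 : ℝ), (0 : ℝ))
    simp only [unip_zero_mul_low_zero, one_smul] at this
    exact this
  obtain ⟨δ, hδ, hb⟩ := Metric.eventually_nhds_iff.1 (h0.eventually hV)
  refine ⟨δ / 2, by positivity, fun s r hs hr => ?_⟩
  refine @hb (s, r) ?_
  rw [Prod.dist_eq, max_lt_iff, Real.dist_0_eq_abs, Real.dist_0_eq_abs]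
  constructor <;> dsimp only <;> linarith

theorem mem_closure_of_hits {L : X} {α : ℝ} (h : ∀ δ > 0, Hits L δ α) :
    L ∈ closure (orbit (Set.Ioi 0) (latticeOf α)) := by
  refine mem_closure_iff_nhds.2 fun V hV => ?_
  obtain ⟨δ, hδ, hb⟩ := exists_forall_smul_mem_of_mem_nhds hV
  obtain ⟨t, ht, s, r, hs, hr, e⟩ := h δ hδ
  exact ⟨diag t • latticeOf α, e ▸ hb s r hs hr, t, ht, rfl⟩

/-- A lattice whose coordinate products are bounded below has bases whose first vector is
arbitrarily long and hugs the horizontal axis, as the product of its coordinates stays bounded.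
By Dirichlet's theorem there are primitive vectors of this kind. -/
theorem exists_long_basis {g : G} {c : ℝ} (hc : 0 < c)
    (hg : ∀ m n : ℤ, ¬ (m = 0 ∧ n = 0) → c ≤ |vec g m n 0 * vec g m n 1|) :
    ∃ C > 0, ∀ (B : ℝ) (M : ℕ), ∃ h : G, toLattice h = toLattice g ∧ B ≤ h 0 0 ∧ 0 < h 0 0 ∧
      |h 0 0 * h 1 0| ≤ C ∧ M * h 0 0 ≤ h 0 1 ∧ h 0 1 < (M + 1) * h 0 0 := by
  refine ⟨|g 0 0 * g 1 0| + 1, by positivity, fun B M => ?_⟩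
  have hcg := hg 1 0 (by simp)
  simp only [vec_zero, vec_one, Int.cast_one, Int.cast_zero, mul_one, mul_zero, add_zero] at hcg
  have hy : g 1 0 ≠ 0 := by
    intro h0
    rw [h0, mul_zero, abs_zero] at hcg
    linarith
  have hy' := abs_pos.2 hy
  obtain ⟨N, hN⟩ := exists_nat_gt (max 1 (B * |g 1 0| / c))
  have hN1 : (1 : ℝ) < N := lt_of_le_of_lt (le_max_left _ _) hN
  have hN2 : B * |g 1 0| / c < N := lt_of_le_of_lt (le_max_right _ _) hN
  obtain ⟨r, hr, hrN⟩ := Real.exists_rat_abs_sub_le_and_den_le (g 1 1 / g 1 0) (n := N)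
    (by exact_mod_cast (by linarith : (0 : ℝ) < N))
  have hden : (0 : ℝ) < r.den := by exact_mod_cast r.den_pos
  have hrN' : (r.den : ℝ) ≤ N := by exact_mod_cast hrN
  -- the second coordinate of the vector with coefficients `(-r.num, r.den)` is small
  have hvy : |vec g (-r.num) r.den 1| ≤ |g 1 0| / (N + 1) := by
    have e : vec g (-r.num) r.den 1 = g 1 0 * (r.den * (g 1 1 / g 1 0 - r)) := by
      have h1 : (r : ℝ) * r.den = r.num := by exact_mod_cast Rat.mul_den_eq_num r
      rw [mul_sub, mul_comm (r.den : ℝ) r, h1, vec_one]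
      push_cast
      field_simp
      ring
    rw [e, abs_mul, abs_mul, abs_of_pos hden, div_eq_mul_one_div |g 1 0|]
    refine mul_le_mul_of_nonneg_left ?_ hy'.le
    calc (r.den : ℝ) * |g 1 1 / g 1 0 - r| ≤ r.den * (1 / ((N + 1) * r.den)) := by gcongr
      _ = 1 / (N + 1) := by field_simp
  have hne : ¬ (-r.num = 0 ∧ (r.den : ℤ) = 0) := fun h => by
    have := r.den_pos
    omega
  have hprod := hg _ _ hne
  have hcop : IsCoprime (-r.num) (r.den : ℤ) :=
    (Rat.isCoprime_num_den r).neg_left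
  set x := vec g (-r.num) r.den 0 with hx
  set y := vec g (-r.num) r.den 1 with hyd
  have hxy : |x * y| ≤ |g 0 0 * g 1 0| + 1 := by
    -- the determinant expresses `x` through `y` and the coefficient `r.den`
    have e : g 1 0 * x = g 0 0 * y - r.den := by
      rw [hx, hyd, vec_zero, vec_one]
      push_cast
      linear_combination (-(r.den : ℝ)) * det_eq g
    have h1 : |g 1 0| * |x * y| ≤ |g 1 0| * (|g 0 0 * g 1 0| + 1) := by
      calc |g 1 0| * |x * y| = |g 1 0 * x| * |y| := by rw [abs_mul, abs_mul]; ring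
        _ ≤ (|g 0 0| * |y| + r.den) * |y| := by
          gcongr
          rw [e]
          refine (abs_sub _ _).trans ?_
          rw [abs_mul, abs_of_pos hden]
        _ ≤ (|g 0 0| * |g 1 0| + (N + 1)) * (|g 1 0| / (N + 1)) := by
          have : |y| ≤ |g 1 0| := hvy.trans (div_le_self hy'.le (by linarith))
          gcongr
          linarith
        _ ≤ |g 1 0| * (|g 0 0 * g 1 0| + 1) := by
          rw [abs_mul]
          have e1 : (|g 0 0| * |g 1 0| + (N + 1)) * (|g 1 0| / (N + 1)) =
            |g 1 0| * (|g 0 0| * |g 1 0| / (N + 1) + 1) := by field_simp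
          rw [e1]
          gcongr
          exact div_le_self (by positivity) (by linarith)
    exact le_of_mul_le_mul_left h1 hy'
  have hxB : B ≤ |x| := by
    rw [abs_mul] at hprod
    have h1 : c ≤ |x| * (|g 1 0| / (N + 1)) := hprod.trans (by gcongr)
    rw [mul_div_assoc', le_div_iff₀ (by linarith)] at h1
    rw [div_lt_iff₀ hc] at hN2
    by_contra hlt
    push Not at hlt
    have := mul_lt_mul_of_pos_right hlt hy'
    nlinarith
  have hx0 : x ≠ 0 := by
    intro h0
    rw [h0, zero_mul, abs_zero] at hprod
    linarith
  -- choose the sign of the vector so that its first coordinate is positive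
  obtain ⟨m, n, hmn, hm0, hm1⟩ : ∃ m n : ℤ, IsCoprime m n ∧ vec g m n 0 = |x| ∧
      |vec g m n 0 * vec g m n 1| = |x * y| := by
    rcases abs_choice x with h | h
    · exact ⟨_, _, hcop, h.symm, rfl⟩
    · have e : ∀ i, vec g (-(-r.num)) (-r.den) i = -vec g (-r.num) r.den i := fun i => by
        fin_cases i <;> simp <;> ring
      exact ⟨-(-r.num), -r.den, hcop.neg_left.neg_right, by rw [e, h],
        by rw [e, e, neg_mul_neg]⟩
  obtain ⟨u, w, huw⟩ := hmn
  set h1 : G := g * intMat m (-w) n u (by linarith) with hh1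
  have e0 : ∀ i, h1 i 0 = vec g m n i := fun i => by
    rw [hh1, mul_intMat_zero]; fin_cases i <;> simp
  have hpos : 0 < h1 0 0 := by rw [e0, hm0]; exact abs_pos.2 hx0
  set k : ℤ := ⌊h1 0 1 / h1 0 0⌋ - M with hk
  refine ⟨h1 * intMat 1 (-k) 0 1 (by ring), ?_, ?_⟩
  · rw [toLattice_mul_intMat, hh1, toLattice_mul_intMat]
  have f0 : ∀ i, (h1 * intMat 1 (-k) 0 1 (by ring)) i 0 = h1 i 0 := fun i => by
    rw [mul_intMat_zero]; push_cast; ring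
  have f1 : (h1 * intMat 1 (-k) 0 1 (by ring)) 0 1 = h1 0 1 - k * h1 0 0 := by
    rw [mul_intMat_one]; push_cast; ring
  rw [f0, f0, f1]
  have hfl := Int.floor_le (h1 0 1 / h1 0 0)
  have hfl' := Int.lt_floor_add_one (h1 0 1 / h1 0 0)
  rw [le_div_iff₀ hpos] at hfl
  rw [div_lt_iff₀ hpos] at hfl'
  have hkc : (k : ℝ) = ⌊h1 0 1 / h1 0 0⌋ - M := by rw [hk]; push_cast; ring
  refine ⟨by rw [e0, hm0]; exact hxB, hpos, by rw [e0, e0, hm1]; exact hxy, ?_, ?_⟩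
  · rw [hkc]; linarith
  · rw [hkc]; linarith

/-- The image of a basis `h` under a Möbius transformation in `SL₂(ℤ)`: the forward orbit of the
lattice of `α = (p θ + p') / (q θ + q')`, where `θ` is the slope of the first row of `h`, meets the
stable leaf of the lattice spanned by `h`. -/
theorem diag_smul_latticeOf_eq {h : G} {p q p' q' : ℤ} (hdet : p * q' - p' * q = 1) {θ J : ℝ}
    (hx : 0 < h 0 0) (hθ : h 0 1 = θ * h 0 0) (hJ : J = q * θ + q') (hJ0 : 0 < J) :
    diag (Real.log (h 0 0 * J)) • latticeOf ((p * θ + p') / J) =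
      low (-((h 0 0 * h 1 0 + q / J) / h 0 0 ^ 2)) • toLattice h := by
  have hd : p * q' - -p' * -q = 1 := by linarith
  have hdr : (p : ℝ) * q' - p' * q = 1 := by exact_mod_cast hdet
  have hdh := det_eq h
  rw [latticeOf, smul_toLattice, smul_toLattice,
    ← toLattice_mul_intMat _ p (-p') (-q) q' hd]
  congr 1
  have hxJ : 0 < h 0 0 * J := by positivity
  have e1 : Real.exp (Real.log (h 0 0 * J)) = h 0 0 * J := Real.exp_log hxJ
  have e2 : Real.exp (-Real.log (h 0 0 * J)) = (h 0 0 * J)⁻¹ := by rw [Real.exp_neg, e1]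
  have d1 : (diag (Real.log (h 0 0 * J)) * unip ((p * θ + p') / J)) 0 0 = h 0 0 * J ∧
      (diag (Real.log (h 0 0 * J)) * unip ((p * θ + p') / J)) 0 1 = h 0 0 * (p * θ + p') ∧
      (diag (Real.log (h 0 0 * J)) * unip ((p * θ + p') / J)) 1 0 = 0 ∧
      (diag (Real.log (h 0 0 * J)) * unip ((p * θ + p') / J)) 1 1 = (h 0 0 * J)⁻¹ := by
    refine ⟨?_, ?_, ?_, ?_⟩ <;> rw [mul_apply_two] <;> simp only [diag_entries, unip_entries, e1, e2]
    · ring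
    · field_simp; ring
    · ring
    · ring
  refine ext_entries ?_ ?_ ?_ ?_ <;> rw [mul_apply_two (low _)] <;>
    simp only [mul_intMat_zero, mul_intMat_one, d1, low_entries] <;> push_cast
  · rw [hJ]; linear_combination (h 0 0) * hdr
  · rw [hθ, hJ]; linear_combination (h 0 0 * θ) * hdr
  · field_simp; ring
  · rw [hθ] at hdh ⊢
    field_simp
    rw [hJ] at *
    linear_combination (-(q * θ + q')) * hdh

/-- If the forward orbit of the lattice of `α` reaches the stable leaf of a lattice with coordinate
products bounded below, then `α` is badly approximable by fractions of large denominator. -/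
theorem min_le_mul_abs_of_smul_eq {h : G} {c C t η J α : ℝ} (hC : 0 < C)
    (hh : ∀ m n : ℤ, ¬ (m = 0 ∧ n = 0) → c ≤ |vec h m n 0 * vec h m n 1|)
    (hx : 0 < h 0 0) (hJ : 0 < J) (ht : Real.exp t = h 0 0 * J) (hη : |η| * h 0 0 ^ 2 ≤ C)
    (heq : diag t • latticeOf α = low (-η) • toLattice h) (u : ℤ) {v : ℕ} (hv : 0 < v) :
    min (c / 2) (√(c / (2 * C)) * (v / J)) ≤ v * |v * α - u| := by
  have hv' : (0 : ℝ) < v := by exact_mod_cast hv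
  have hmem : vec (diag t * unip α) (-u) v ∈ (toLattice (low (-η) * h)).1 := by
    rw [← smul_toLattice, ← heq, latticeOf, smul_toLattice]
    exact vec_mem _ _ _
  obtain ⟨m, n, hmn⟩ := mem_toLattice.1 hmem
  rw [vec_diag_mul, vec_unip, vec_low_mul] at hmn
  have e0 := congrFun hmn 0
  have e1 := congrFun hmn 1
  simp only [Matrix.cons_val_zero, Matrix.cons_val_one] at e0 e1
  push_cast at e0 e1
  have hne : ¬ (m = 0 ∧ n = 0) := by
    rintro ⟨rfl, rfl⟩
    simp at e1
    omega
  have hprod := hh m n hne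
  generalize vec h m n 0 = x at *
  generalize vec h m n 1 = y at *
  have he : Real.exp t * Real.exp (-t) = 1 := by rw [← Real.exp_add]; simp
  have key : (v : ℝ) * |v * α - u| = |x| * |y + -η * x| := by
    rw [← e1, ← e0, ← abs_mul]
    have : Real.exp t * (-u + α * v) * (Real.exp (-t) * v) = v * (v * α - u) := by
      linear_combination (v * (v * α - u)) * he
    rw [this, abs_mul, abs_of_pos hv']
  rw [key]
  rcases le_or_gt |η * x| (|y| / 2) with h1 | h1
  · refine (min_le_left _ _).trans ?_
    have h2 : |y| / 2 ≤ |y + -η * x| := by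
      have := abs_sub_abs_le_abs_sub y (η * x)
      have e : y + -η * x = y - η * x := by ring
      rw [e]; linarith
    rw [abs_mul] at hprod
    nlinarith [abs_nonneg x]
  · refine (min_le_right _ _).trans ?_
    -- here `y` is negligible, so the bound on `η` forces `x` to be comparable with `h 0 0`
    have h2 : c * h 0 0 ^ 2 ≤ 2 * C * x ^ 2 := by
      have h3 : c ≤ 2 * |η| * x ^ 2 := by
        rw [abs_mul] at hprod h1
        rw [← sq_abs x]
        nlinarith [abs_nonneg x]
      nlinarith [sq_nonneg (h 0 0), sq_nonneg x]
    have h3 : √(c / (2 * C)) * h 0 0 ≤ |x| := by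
      have : √(c / (2 * C)) ≤ |x| / h 0 0 := by
        refine Real.sqrt_le_iff.2 ⟨by positivity, ?_⟩
        rw [div_pow, sq_abs, div_le_div_iff₀ (by positivity) (by positivity)]
        linarith
      rwa [le_div_iff₀ hx] at this
    have h4 : |y + -η * x| = v / (h 0 0 * J) := by
      rw [← e1, Real.exp_neg, ht, abs_of_pos (by positivity)]; field_simp
    rw [h4]
    calc √(c / (2 * C)) * (v / J) = √(c / (2 * C)) * h 0 0 * (v / (h 0 0 * J)) := by field_simp
      _ ≤ |x| * (v / (h 0 0 * J)) := by gcongr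

/-- A number without good approximations of denominator below `B` has a good approximation whose
denominator is comparable with `B`, and which is part of a basis of `ℤ²`. -/
theorem exists_fraction {x : ℝ} {B E : ℕ} (hB : 0 < B) (hE : 0 < E)
    (hx : ∀ (p : ℤ) (q : ℕ), 0 < q → q < B → 1 / ((E : ℝ) * B) ≤ |q * x - p|) :
    ∃ p p' q q' : ℤ, p * q' - p' * q = 1 ∧ B ≤ q ∧ q ≤ E * B ∧ 0 ≤ q' ∧ q' < q ∧
      |x - p / q| ≤ 1 / (E * B * q) := by
  have hEB : (0 : ℝ) < E * B := by positivity
  obtain ⟨r, hr, hrN⟩ := Real.exists_rat_abs_sub_le_and_den_le x (n := E * B) (by positivity)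
  have hden : (0 : ℝ) < r.den := by exact_mod_cast r.den_pos
  push_cast at hr
  have hrden : (r : ℝ) * r.den = r.num := by exact_mod_cast Rat.mul_den_eq_num r
  have hrdiv : (r : ℝ) = r.num / (r.den : ℤ) := by
    rw [eq_div_iff (by exact_mod_cast hden.ne')]; exact_mod_cast hrden
  have hBq : B ≤ r.den := by
    by_contra hlt
    push Not at hlt
    have h1 := hx r.num r.den r.den_pos hlt
    have h2 : (r.den : ℝ) * x - r.num = r.den * (x - r) := by rw [← hrden]; ring
    rw [h2, abs_mul, abs_of_pos hden] at h1
    have h3 : (r.den : ℝ) * |x - r| ≤ 1 / (E * B + 1) := by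
      calc (r.den : ℝ) * |x - r| ≤ r.den * (1 / ((E * B + 1) * r.den)) := by gcongr
        _ = 1 / (E * B + 1) := by field_simp
    have h4 : 1 / ((E : ℝ) * B + 1) < 1 / (E * B) := one_div_lt_one_div_of_lt hEB (by linarith)
    linarith
  obtain ⟨u, w, huw⟩ := Rat.isCoprime_num_den r
  have hpos : (0 : ℤ) < r.den := by exact_mod_cast r.den_pos
  refine ⟨r.num, -w - r.num * (u / r.den), r.den, u % r.den, ?_, by exact_mod_cast hBq,
    by exact_mod_cast hrN, Int.emod_nonneg _ hpos.ne', Int.emod_lt_of_pos _ hpos, ?_⟩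
  · have := Int.emod_add_mul_ediv u r.den
    linear_combination huw + r.num * this
  · rw [← hrdiv]
    refine hr.trans (one_div_le_one_div_of_le ?_ ?_)
    · push_cast; positivity
    · push_cast
      gcongr
      linarith

/-- Near every point that is not too well approximable at scale `b ^ n` there is a number `α` whose
forward orbit soon passes through the stable leaf of the given lattice, close to that lattice.
The constant `c₁` that measures how badly `α` is approximable from denominator `b ^ n` on does not
depend on the closeness `δ`. -/
theorem exists_center {g : G} {c : ℝ} (hc : 0 < c)
    (hg : ∀ m n : ℤ, ¬ (m = 0 ∧ n = 0) → c ≤ |vec g m n 0 * vec g m n 1|)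
    {b : ℕ} (hb : 8 ≤ b) :
    ∃ c₁ > 0, ∀ δ > 0, ∃ T > 0, ∀ (n : ℕ) (x : ℝ),
      (∀ (p : ℤ) (q : ℕ), 0 < q → q < b ^ n → 1 / (2 * (b : ℝ) ^ 3 * b ^ n) ≤ |q * x - p|) →
      ∃ α, |α - x| ≤ 1 / (8 * (b : ℝ) ^ (2 * n + 2)) ∧
        (∃ t > 0, ∃ r, |r| ≤ δ ∧ diag t • latticeOf α = low r • toLattice g ∧
          Real.exp t ≤ T * b ^ n) ∧
        ∀ (u : ℤ) (v : ℕ), b ^ n ≤ v → c₁ ≤ v * |v * α - u| := by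
  obtain ⟨C, hC, hbasis⟩ := exists_long_basis hc hg
  have hb0 : (0 : ℝ) < b := by exact_mod_cast (by omega : 0 < b)
  have hb8 : (8 : ℝ) ≤ b := by exact_mod_cast hb
  -- `M` is the size of the slope `θ` of the basis, `E` the quality of approximation
  set M : ℕ := 16 * b ^ 2 with hM
  set E : ℕ := 2 * b ^ 3 with hE
  have hE0 : 0 < E := by positivity
  have hM0 : 1 ≤ M := by
    have : 0 < M := by positivity
    omega
  have hMr : (1 : ℝ) ≤ M := by exact_mod_cast hM0
  have hMr' : (M : ℝ) = 16 * b ^ 2 := by rw [hM]; push_cast; ring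
  have hEr : (0 : ℝ) < E := by exact_mod_cast hE0
  have hEr' : (E : ℝ) = 2 * b ^ 3 := by rw [hE]; push_cast; ring
  refine ⟨min (c / 2) (√(c / (2 * (C + 1))) * (1 / (E * (M + 2)))),
    lt_min (by positivity) (by positivity), fun δ hδ => ?_⟩
  obtain ⟨h, hhg, hhB, hh0, hhC, hθ1, hθ2⟩ := hbasis (max 1 ((C + 1) / δ)) M
  have hh1 : 1 ≤ h 0 0 := (le_max_left _ _).trans hhB
  have hhδ : (C + 1) / δ ≤ h 0 0 := (le_max_right _ _).trans hhB
  have hprod : ∀ m n : ℤ, ¬ (m = 0 ∧ n = 0) → c ≤ |vec h m n 0 * vec h m n 1| := fun m n hmn => by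
    have h1 := vec_mem h m n
    rw [hhg] at h1
    obtain ⟨m', n', h2⟩ := mem_toLattice.1 h1
    rw [h2]
    refine hg m' n' fun h3 => hmn ?_
    rwa [← vec_eq_zero_iff h, h2, vec_eq_zero_iff]
  refine ⟨h 0 0 * (E * (M + 2)), by positivity, fun n x hx => ?_⟩
  have hbn : (1 : ℝ) ≤ (b : ℝ) ^ n := one_le_pow₀ (by linarith)
  obtain ⟨p, p', q, q', hdet, hqB, hqE, hq0, hqq, hxp⟩ := exists_fraction (x := x) (B := b ^ n)
    (E := E) (by positivity) hE0 (fun p q h1 h2 => by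
      have := hx p q h1 h2
      rw [hEr']; push_cast; exact this)
  have hqBr : (b : ℝ) ^ n ≤ q := by exact_mod_cast hqB
  have hqEr : (q : ℝ) ≤ E * b ^ n := by exact_mod_cast hqE
  have hq'0 : (0 : ℝ) ≤ q' := by exact_mod_cast hq0
  have hq'q : (q' : ℝ) ≤ q := by exact_mod_cast hqq.le
  have hqpos : (0 : ℝ) < q := by linarith
  set θ : ℝ := h 0 1 / h 0 0 with hθ
  have hθe : h 0 1 = θ * h 0 0 := by rw [hθ]; field_simp
  have hθM : M ≤ θ := by rw [hθ, le_div_iff₀ hh0]; exact hθ1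
  have hθM' : θ ≤ M + 1 := by rw [hθ, div_le_iff₀ hh0]; exact hθ2.le
  set J : ℝ := q * θ + q' with hJ
  have hJlow : q * M ≤ J := by
    rw [hJ]; linarith [mul_le_mul_of_nonneg_left hθM hqpos.le]
  have hJbn : (b : ℝ) ^ n * M ≤ J := le_trans (by gcongr) hJlow
  have hJ0 : 0 < J := lt_of_lt_of_le (by positivity) hJbn
  have hqJ : q ≤ J := (le_mul_of_one_le_right hqpos.le hMr).trans hJlow
  have hJ1 : 1 < J := by
    have h1 : 1 * 16 ≤ (b : ℝ) ^ n * M := by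
      refine mul_le_mul hbn ?_ (by norm_num) (by positivity)
      rw [hMr']
      linarith [one_le_pow₀ (by linarith : (1 : ℝ) ≤ b) (n := 2)]
    linarith
  have hJup : J ≤ E * (M + 2) * b ^ n := by
    have h1 : J ≤ q * (M + 2) := by
      rw [hJ]; linarith [mul_le_mul_of_nonneg_left hθM' hqpos.le]
    have h2 : q * ((M : ℝ) + 2) ≤ E * b ^ n * (M + 2) := by gcongr
    linarith
  have heq := diag_smul_latticeOf_eq hdet hh0 hθe hJ hJ0
  set η : ℝ := (h 0 0 * h 1 0 + q / J) / h 0 0 ^ 2 with hη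
  have hηC : |η| * h 0 0 ^ 2 ≤ C + 1 := by
    rw [hη, abs_div, abs_of_pos (by positivity : 0 < h 0 0 ^ 2), div_mul_cancel₀ _ (by positivity)]
    refine (abs_add_le _ _).trans (add_le_add hhC ?_)
    rw [abs_of_pos (by positivity)]
    exact div_le_one_of_le₀ hqJ hJ0.le
  have hexp : Real.exp (Real.log (h 0 0 * J)) = h 0 0 * J := Real.exp_log (by positivity)
  refine ⟨(p * θ + p') / J, ?_, ⟨Real.log (h 0 0 * J), ?_, -η, ?_, by rw [← hhg]; exact heq, ?_⟩, ?_⟩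
  · -- both `α` and `x` are close to `p / q`
    have hdr : (p : ℝ) * q' - p' * q = 1 := by exact_mod_cast hdet
    have h1 : |(p * θ + p') / J - p / q| ≤ 1 / (16 * (b : ℝ) ^ (2 * n + 2)) := by
      have e : (p * θ + p') / J - p / q = -(1 / (q * J)) := by
        field_simp
        rw [hJ]
        linear_combination -hdr
      rw [e, abs_neg, abs_of_pos (by positivity)]
      refine one_div_le_one_div_of_le (by positivity) ?_
      calc 16 * (b : ℝ) ^ (2 * n + 2) = b ^ n * (b ^ n * M) := by rw [hMr']; ring
        _ ≤ q * J := by gcongr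
    have h2 : |x - p / q| ≤ 1 / (16 * (b : ℝ) ^ (2 * n + 2)) := by
      refine hxp.trans (one_div_le_one_div_of_le (by positivity) ?_)
      calc 16 * (b : ℝ) ^ (2 * n + 2) ≤ 2 * b * b ^ (2 * n + 2) := by gcongr; linarith
        _ = E * b ^ n * b ^ n := by rw [hEr']; ring
        _ ≤ E * (b ^ n : ℕ) * q := by push_cast; gcongr
    have h3 := abs_sub_le ((p * θ + p') / J) (p / q) x
    rw [abs_sub_comm (p / q : ℝ) x] at h3
    have e : 1 / (8 * (b : ℝ) ^ (2 * n + 2)) = 1 / (16 * (b : ℝ) ^ (2 * n + 2)) +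
      1 / (16 * (b : ℝ) ^ (2 * n + 2)) := by field_simp; norm_num
    linarith
  · refine Real.log_pos ?_
    exact one_lt_mul_of_le_of_lt hh1 hJ1
  · rw [abs_neg]
    rw [div_le_iff₀ hδ] at hhδ
    have h1 : |η| * h 0 0 ^ 2 ≤ δ * h 0 0 ^ 2 := by
      have h2 : h 0 0 * δ ≤ h 0 0 * δ * h 0 0 := le_mul_of_one_le_right (by positivity) hh1
      linarith
    exact le_of_mul_le_mul_right h1 (by positivity)
  · rw [hexp]
    calc h 0 0 * J ≤ h 0 0 * (E * (M + 2) * b ^ n) := by gcongr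
      _ = _ := by ring
  · intro u v hv
    have hvr : (b : ℝ) ^ n ≤ v := by exact_mod_cast hv
    have hv0 : 0 < v := lt_of_lt_of_le (by positivity) hv
    have h1 := min_le_mul_abs_of_smul_eq (by linarith : 0 < C + 1) hprod hh0 hJ0 hexp hηC heq u hv0
    have h2 : 1 / (E * ((M : ℝ) + 2)) ≤ v / J := by
      rw [div_le_div_iff₀ (by positivity) hJ0, one_mul]
      calc J ≤ E * (M + 2) * b ^ n := hJup
        _ ≤ E * (M + 2) * v := mul_le_mul_of_nonneg_left hvr (by positivity)
        _ = v * (E * (M + 2)) := by ring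
    exact le_trans (min_le_min le_rfl (mul_le_mul_of_nonneg_left h2 (Real.sqrt_nonneg _))) h1

/-! ### Nested intervals avoiding fractions -/

/-- The length of the intervals of level `n` in base `b`. Two distinct fractions with denominators
below `b ^ (n + 1)` are more than twice this length apart. -/
noncomputable def width (b n : ℕ) : ℝ := 1 / (2 * (b : ℝ) ^ (2 * n + 2))

theorem width_pos {b : ℕ} (hb : 0 < b) (n : ℕ) : 0 < width b n := by
  unfold width; positivity

theorem width_add {b : ℕ} (hb : 0 < b) (n m : ℕ) :
    width b (n + m) * (b : ℝ) ^ (2 * m) = width b n := by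
  unfold width; field_simp; ring

/-- Distinct fractions with denominators below `B` are more than `1 / B ^ 2` apart. -/
theorem fraction_gap {p p' : ℤ} {q q' B : ℕ} (hq : 0 < q) (hqB : q < B) (hq' : 0 < q')
    (hqB' : q' < B) (h : |(p : ℝ) / q - p' / q'| ≤ 1 / (B : ℝ) ^ 2) : (p : ℝ) / q = p' / q' := by
  have h1 : (0 : ℝ) < q := by exact_mod_cast hq
  have h2 : (0 : ℝ) < q' := by exact_mod_cast hq'
  have h3 : (q : ℝ) < B := by exact_mod_cast hqB
  have h4 : (q' : ℝ) < B := by exact_mod_cast hqB'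
  have h0 : (0 : ℝ) < B := by linarith
  rw [div_sub_div _ _ h1.ne' h2.ne', abs_div, abs_of_pos (by positivity : 0 < (q : ℝ) * q'),
    div_le_div_iff₀ (by positivity) (by positivity)] at h
  have h5 : (q : ℝ) * q' < B ^ 2 := by nlinarith
  have h6 : |(p : ℝ) * q' - q * p'| < 1 := by
    by_contra hlt
    push Not at hlt
    nlinarith
  have h7 : p * q' - q * p' = 0 := by
    rw [← Int.abs_lt_one_iff]
    exact_mod_cast h6
  rw [div_eq_div_iff h1.ne' h2.ne']
  have : (p : ℝ) * q' - q * p' = 0 := by exact_mod_cast h7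
  linarith

/-- An interval of level `n` has `N` well separated subintervals of level `n + 1` which stay away
from all fractions with denominator below `b ^ (n + 1)`. Only one such fraction can be near the
given interval, and it spoils at most one of the `N + 1` candidates. -/
theorem exists_children {b N : ℕ} (hb : b ^ 2 = 4 * (N + 1)) (n : ℕ) (a : ℝ) :
    ∃ f : Fin N → ℝ,
      (∀ d, Set.Icc (f d) (f d + width b (n + 1)) ⊆ Set.Icc a (a + width b n)) ∧
      (∀ d d', d ≠ d' → ∀ x ∈ Set.Icc (f d) (f d + width b (n + 1)),
        ∀ y ∈ Set.Icc (f d') (f d' + width b (n + 1)), width b (n + 1) ≤ |x - y|) ∧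
      ∀ d, ∀ x ∈ Set.Icc (f d) (f d + width b (n + 1)), ∀ (p : ℤ) (q : ℕ), 0 < q →
        q < b ^ (n + 1) → q * width b (n + 1) ≤ |q * x - p| := by
  have hb0 : 0 < b := by
    rcases Nat.eq_zero_or_pos b with h | h
    · rw [h] at hb; omega
    · exact h
  set w := width b (n + 1) with hw
  have hw0 : 0 < w := width_pos hb0 _
  have hbr : (b : ℝ) ^ 2 = 4 * (N + 1) := by exact_mod_cast hb
  have hwn : width b n = 4 * (N + 1) * w := by
    rw [← width_add hb0 n 1, ← hbr, mul_comm]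
  have hgap : 1 / ((b ^ (n + 1) : ℕ) : ℝ) ^ 2 = 2 * (4 * (N + 1) * w) := by
    rw [← hwn, width]; push_cast; field_simp; ring
  have hsep : ∀ i j : Fin (N + 1), i ≠ j → ∀ x ∈ Set.Icc (a + 4 * i * w) (a + 4 * i * w + w),
      ∀ y ∈ Set.Icc (a + 4 * j * w) (a + 4 * j * w + w), 3 * w ≤ |x - y| := by
    intro i j hij x hx y hy
    rcases lt_or_gt_of_ne hij with h | h
    · have h1 : (i : ℝ) + 1 ≤ j := by exact_mod_cast h
      rw [abs_sub_comm]
      refine le_trans ?_ (le_abs_self _)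
      nlinarith [hx.2, hy.1]
    · have h1 : (j : ℝ) + 1 ≤ i := by exact_mod_cast h
      refine le_trans ?_ (le_abs_self _)
      nlinarith [hx.1, hy.2]
  have hsub : ∀ j : Fin (N + 1), Set.Icc (a + 4 * j * w) (a + 4 * j * w + w) ⊆
      Set.Icc a (a + width b n) := by
    intro j x hx
    have h1 : (j : ℝ) ≤ N := by exact_mod_cast Nat.lt_succ_iff.1 j.2
    have h0 : (0 : ℝ) ≤ j := by positivity
    have h2 : 4 * (j : ℝ) * w ≤ 4 * N * w := by gcongr
    have h3 : 0 ≤ 4 * (j : ℝ) * w := by positivity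
    rw [hwn]
    exact ⟨by linarith [hx.1], by linarith [hx.2]⟩
  obtain ⟨j₀, hj₀⟩ : ∃ j₀ : Fin (N + 1), ∀ j ≠ j₀,
      ∀ x ∈ Set.Icc (a + 4 * j * w) (a + 4 * j * w + w), ∀ (p : ℤ) (q : ℕ), 0 < q →
        q < b ^ (n + 1) → w ≤ |x - p / q| := by
    by_cases hex : ∃ j₀ : Fin (N + 1), ∃ x ∈ Set.Icc (a + 4 * j₀ * w) (a + 4 * j₀ * w + w),
      ∃ (p : ℤ) (q : ℕ), 0 < q ∧ q < b ^ (n + 1) ∧ |x - p / q| < w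
    · obtain ⟨j₀, x, hx, p, q, hq, hqb, hlt⟩ := hex
      refine ⟨j₀, fun j hj y hy p' q' hq' hqb' => ?_⟩
      by_contra hlt'
      push Not at hlt'
      have hx' := hsub _ hx
      have hy' := hsub _ hy
      rw [hwn] at hx' hy'
      have hxy : |x - y| ≤ 4 * (N + 1) * w :=
        abs_sub_le_iff.2 ⟨by linarith [hx'.2, hy'.1], by linarith [hx'.1, hy'.2]⟩
      have e : (p : ℝ) / q = p' / q' := by
        refine fraction_gap hq hqb hq' hqb' ?_
        rw [hgap]
        have h1 := abs_sub_le (p / q : ℝ) x (p' / q')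
        have h2 := abs_sub_le x y (p' / q')
        rw [abs_sub_comm (p / q : ℝ) x] at h1
        have hN : 0 ≤ (N : ℝ) * w := by positivity
        linarith
      have h3 := hsep j₀ j (Ne.symm hj) x hx y hy
      have h4 := abs_sub_le x (p / q) y
      rw [e] at h4 hlt
      rw [abs_sub_comm (p' / q' : ℝ) y] at h4
      linarith
    · push Not at hex
      exact ⟨0, fun j _ x hx p q hq hqb => hex j x hx p q hq hqb⟩
  refine ⟨fun d => a + 4 * (j₀.succAbove d : ℕ) * w, fun d => hsub _, ?_, ?_⟩
  · intro d d' hd x hx y hy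
    have := hsep _ _ (fun h => hd (Fin.succAbove_right_injective h)) x hx y hy
    linarith
  · intro d x hx p q hq hqb
    have h1 := hj₀ _ (Fin.succAbove_ne j₀ d) x hx p q hq hqb
    have hq0 : (0 : ℝ) < q := by exact_mod_cast hq
    have e : (q : ℝ) * x - p = q * (x - p / q) := by field_simp
    rw [e, abs_mul, abs_of_pos hq0]
    gcongr

/-- Inside an interval of level `n` whose points are not too well approximable there is a
subinterval, a bounded number `m` of levels further down, all of whose points have a forward orbit
passing `δ`-close to the given lattice. The number `m` of levels depends on `δ`, but the constant `c'`
in the Diophantine bound does not. -/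
theorem exists_insertion {g : G} {c : ℝ} (hc : 0 < c)
    (hg : ∀ m n : ℤ, ¬ (m = 0 ∧ n = 0) → c ≤ |vec g m n 0 * vec g m n 1|)
    {b N : ℕ} (hb8 : 8 ≤ b) (hb : b ^ 2 = 4 * (N + 1)) :
    ∃ c' > 0, c' ≤ 1 / (2 * (b : ℝ) ^ 4) ∧ ∀ δ > 0, ∃ m : ℕ, ∀ (n : ℕ) (a : ℝ),
      (∀ x ∈ Set.Icc a (a + width b n), ∀ (p : ℤ) (q : ℕ), 0 < q → q < b ^ n →
        1 / (2 * (b : ℝ) ^ 3 * b ^ n) ≤ |q * x - p|) →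
      ∃ a', Set.Icc a' (a' + width b (n + m)) ⊆ Set.Icc a (a + width b n) ∧
        ∀ x ∈ Set.Icc a' (a' + width b (n + m)), Hits (toLattice g) δ x ∧
          ∀ (p : ℤ) (q : ℕ), b ^ n ≤ q → q < b ^ (n + m) → c' ≤ q * |q * x - p| := by
  obtain ⟨c₁, hc₁, hcen⟩ := exists_center hc hg hb8
  have hb0 : 0 < b := by omega
  have hbr : (8 : ℝ) ≤ b := by exact_mod_cast hb8
  have hb1 : (1 : ℝ) < b := by linarith
  have hbpos : (0 : ℝ) < b := by linarith
  obtain ⟨j, hj⟩ := pow_unbounded_of_one_lt (1 / c₁) hb1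
  have hj2 : 1 / c₁ ≤ (b : ℝ) ^ (2 * j) :=
    hj.le.trans (pow_le_pow_right₀ hb1.le (by omega))
  refine ⟨min (c₁ / 2) (1 / (2 * (b : ℝ) ^ (2 * j + 4))), lt_min (by positivity) (by positivity),
    (min_le_right _ _).trans (one_div_le_one_div_of_le (by positivity) ?_), fun δ hδ => ?_⟩
  · gcongr
    · exact hb1.le
    · omega
  obtain ⟨T, hT, hcen⟩ := hcen δ hδ
  obtain ⟨k, hk⟩ := pow_unbounded_of_one_lt (T ^ 2 / δ) hb1
  set m : ℕ := k + 1 with hm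
  have hm2 : T ^ 2 ≤ δ * (b : ℝ) ^ (2 * m) := by
    rw [div_lt_iff₀ hδ] at hk
    have : (b : ℝ) ^ k ≤ (b : ℝ) ^ (2 * m) := pow_le_pow_right₀ hb1.le (by omega)
    nlinarith
  refine ⟨m + 1, fun n a ha => ?_⟩
  have hwn := width_pos hb0 n
  obtain ⟨α, hα, ⟨t, ht, r, hr, heq, hexp⟩, hαb⟩ := hcen n (a + width b n / 2)
    (ha _ ⟨by linarith, by linarith⟩)
  have hw4 : 1 / (8 * (b : ℝ) ^ (2 * n + 2)) = width b n / 4 := by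
    unfold width; field_simp; norm_num
  rw [hw4, abs_le] at hα
  have hwm := width_add hb0 n m
  have hwmpos := width_pos hb0 (n + m)
  have hwm4 : width b (n + m) * 4 ≤ width b n := by
    rw [← hwm]
    gcongr
    calc (4 : ℝ) ≤ b ^ 1 := by linarith
      _ ≤ b ^ (2 * m) := pow_le_pow_right₀ hb1.le (by omega)
  have hN : 0 < N := by
    have : 8 ^ 2 ≤ b ^ 2 := Nat.pow_le_pow_left hb8 2
    omega
  obtain ⟨f, hf1, -, hf3⟩ := exists_children hb (n + m) α
  have hsub1 : Set.Icc α (α + width b (n + m)) ⊆ Set.Icc a (a + width b n) :=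
    Set.Icc_subset_Icc (by linarith) (by linarith)
  refine ⟨f ⟨0, hN⟩, (hf1 _).trans hsub1, fun x hx => ⟨?_, fun p q hq1 hq2 => ?_⟩⟩
  · have hx' := hf1 _ hx
    have hxα : 0 ≤ x - α := by linarith [hx'.1]
    have hxα' : x - α ≤ width b (n + m) := by linarith [hx'.2]
    refine ⟨t, ht, Real.exp t ^ 2 * (x - α), r, ?_, hr, ?_⟩
    · rw [abs_mul, abs_of_nonneg hxα, abs_of_nonneg (by positivity)]
      calc Real.exp t ^ 2 * (x - α) ≤ (T * b ^ n) ^ 2 * width b (n + m) := by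
            gcongr
        _ ≤ (δ * (b : ℝ) ^ (2 * m)) * (b ^ n) ^ 2 * width b (n + m) := by
            rw [mul_pow]; gcongr
        _ = δ * (b ^ n) ^ 2 * width b n := by rw [← hwm]; ring
        _ = δ * (1 / (2 * (b : ℝ) ^ 2)) := by unfold width; field_simp; ring
        _ ≤ δ * 1 := by
            gcongr
            rw [div_le_one (by positivity)]
            nlinarith
        _ = δ := mul_one _
    · rw [mul_smul, ← heq, ← mul_smul, ← diag_mul_unip, mul_smul]
      congr 1
      rw [latticeOf, latticeOf, smul_toLattice, ← unip_add]
      congr 2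
      ring
  · have hx' := hf1 _ hx
    have hq0 : 0 < q := lt_of_lt_of_le (by positivity) hq1
    have hq0r : (0 : ℝ) < q := by exact_mod_cast hq0
    -- denominators well below the new scale are controlled by the centre `α`, the others by
    -- the choice of the subinterval
    rcases lt_or_ge ((q : ℝ) * b ^ j) (b ^ (n + m)) with hcase | hcase
    · refine (min_le_left _ _).trans ?_
      have h1 := hαb p q hq1
      have h2 : |(q : ℝ) * α - p| ≤ |q * x - p| + q * width b (n + m) := by
        have h3 := abs_sub_le ((q : ℝ) * α) (q * x) p
        have h4 : |(q : ℝ) * α - q * x| ≤ q * width b (n + m) := by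
          rw [← mul_sub, abs_mul, abs_of_pos hq0r]
          gcongr
          exact abs_sub_le_iff.2 ⟨by linarith [hx'.1], by linarith [hx'.2]⟩
        linarith
      have h5 : (q : ℝ) * (q * width b (n + m)) ≤ c₁ / 2 := by
        have h6 : ((q : ℝ) * b ^ j) ^ 2 ≤ (b ^ (n + m)) ^ 2 := by gcongr
        have h7 : ((b : ℝ) ^ (n + m)) ^ 2 * width b (n + m) ≤ 1 / 2 := by
          have e : ((b : ℝ) ^ (n + m)) ^ 2 * width b (n + m) = 1 / 2 * (1 / (b : ℝ) ^ 2) := by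
            unfold width; field_simp; ring
          rw [e]
          have : 1 / (b : ℝ) ^ 2 ≤ 1 := by
            rw [div_le_one (by positivity)]; nlinarith
          linarith
        have h8 : (q : ℝ) * (q * width b (n + m)) * b ^ (2 * j) ≤ 1 / 2 := by
          calc (q : ℝ) * (q * width b (n + m)) * b ^ (2 * j)
              = (q * b ^ j) ^ 2 * width b (n + m) := by ring
            _ ≤ (b ^ (n + m)) ^ 2 * width b (n + m) := by gcongr
            _ ≤ 1 / 2 := h7
        rw [div_le_iff₀ hc₁] at hj2
        have h9 : (0 : ℝ) < b ^ (2 * j) := by positivity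
        by_contra hlt
        push Not at hlt
        nlinarith
      nlinarith
    · refine (min_le_right _ _).trans ?_
      have h1 := hf3 _ x hx p q hq0 (by rwa [add_assoc])
      calc 1 / (2 * (b : ℝ) ^ (2 * j + 4))
          = (b ^ (n + m) / b ^ j) ^ 2 * width b (n + m + 1) := by
            unfold width; field_simp; ring
        _ ≤ (q : ℝ) ^ 2 * width b (n + m + 1) := by
            have : (0 : ℝ) ≤ width b (n + m + 1) := (width_pos hb0 _).le
            gcongr
            rwa [div_le_iff₀ (by positivity)]
        _ = q * (q * width b (n + m + 1)) := by ring
        _ ≤ _ := by gcongr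

/-! ### Cantor sets and their dimension -/

/-- A nested interval construction with `N` choices at every step produces points indexed by digit
sequences; points whose sequences first differ at place `i` are separated by the distance `s i`
of the children chosen there. -/
theorem exists_cantor {N : ℕ} {w s : ℕ → ℝ} (hw : ∀ i, 0 ≤ w i) {Q : ℕ → ℝ → Prop} (a₀ : ℝ)
    (h₀ : ∀ x ∈ Set.Icc a₀ (a₀ + w 0), Q 0 x)
    (step : ∀ i a, (∀ x ∈ Set.Icc a (a + w i), Q i x) → ∃ f : Fin N → ℝ,
      (∀ d, Set.Icc (f d) (f d + w (i + 1)) ⊆ Set.Icc a (a + w i)) ∧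
      (∀ d d', d ≠ d' → ∀ x ∈ Set.Icc (f d) (f d + w (i + 1)),
        ∀ y ∈ Set.Icc (f d') (f d' + w (i + 1)), s i ≤ |x - y|) ∧
      ∀ d, ∀ x ∈ Set.Icc (f d) (f d + w (i + 1)), Q (i + 1) x) :
    ∃ ψ : (ℕ → Fin N) → ℝ, (∀ ω i, Q i (ψ ω)) ∧
      ∀ ω ω' i, (∀ j < i, ω j = ω' j) → ω i ≠ ω' i → s i ≤ |ψ ω - ψ ω'| := by
  choose f hsub hsep hQ using step
  let node (ω : ℕ → Fin N) (i : ℕ) : {a : ℝ // ∀ x ∈ Set.Icc a (a + w i), Q i x} :=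
    Nat.rec ⟨a₀, h₀⟩ (fun i p => ⟨f i p.1 p.2 (ω i), hQ i p.1 p.2 (ω i)⟩) i
  have node_succ : ∀ ω i, (node ω (i + 1)).1 = f i (node ω i).1 (node ω i).2 (ω i) :=
    fun _ _ => rfl
  have node_congr : ∀ ω ω' i, (∀ j < i, ω j = ω' j) → node ω i = node ω' i := by
    intro ω ω' i
    induction i with
    | zero => intro _; rfl
    | succ i ih =>
      intro h
      refine Subtype.ext ?_
      rw [node_succ, node_succ, ih fun j hj => h j (by omega), h i (by omega)]
  have hne : ∀ ω, (⋂ i, Set.Icc (node ω i).1 ((node ω i).1 + w i)).Nonempty := by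
    intro ω
    refine IsCompact.nonempty_iInter_of_sequence_nonempty_isCompact_isClosed _ (fun i => ?_)
      (fun i => ?_) isCompact_Icc (fun i => isClosed_Icc)
    · rw [node_succ]; exact hsub i _ _ _
    · exact ⟨_, le_rfl, by linarith [hw i]⟩
  choose ψ hψ using hne
  simp only [Set.mem_iInter] at hψ
  refine ⟨ψ, fun ω i => (node ω i).2 _ (hψ ω i), fun ω ω' i hlt hi => ?_⟩
  have h1 := hψ ω (i + 1)
  have h2 := hψ ω' (i + 1)
  rw [node_succ] at h1 h2
  rw [← node_congr ω ω' i hlt] at h2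
  exact hsep i _ _ _ _ hi _ h1 _ h2

/-- Reading off the digits maps a Cantor set onto the unit interval. If this map is Hölder
continuous of exponent `r`, then the Cantor set has dimension at least `r`. -/
theorem le_dimH_range {N : ℕ} (hN : 2 ≤ N) {s : ℕ → ℝ} (hs : ∀ i, 0 < s i)
    {ψ : (ℕ → Fin N) → ℝ}
    (hψ : ∀ ω ω' i, (∀ j < i, ω j = ω' j) → ω i ≠ ω' i → s i ≤ |ψ ω - ψ ω'|)
    {r C : ℝ≥0} (hr : 0 < r) (hC : ∀ i, ((N : ℝ) ^ i)⁻¹ ≤ C * s i ^ (r : ℝ)) :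
    (r : ℝ≥0∞) ≤ dimH (Set.range ψ) := by
  have : Nonempty (ℕ → Fin N) := ⟨fun _ => ⟨0, by omega⟩⟩
  have hfirst : ∀ ω ω' : ℕ → Fin N, ω ≠ ω' → ∃ i, (∀ j < i, ω j = ω' j) ∧ ω i ≠ ω' i := by
    intro ω ω' h
    have hex := Function.ne_iff.1 h
    classical
    exact ⟨Nat.find hex, fun j hj => not_not.1 (Nat.find_min hex hj), Nat.find_spec hex⟩
  have hinj : Function.Injective ψ := by
    intro ω ω' h
    by_contra hne
    obtain ⟨i, h1, h2⟩ := hfirst ω ω' hne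
    have := hψ ω ω' i h1 h2
    rw [h, sub_self, abs_zero] at this
    linarith [hs i]
  set F : ℝ → ℝ := fun x => Real.ofDigits (Function.invFun ψ x) with hF
  have hFψ : ∀ ω, F (ψ ω) = Real.ofDigits ω := fun ω => by
    rw [hF]; simp only [Function.leftInverse_invFun hinj ω]
  have hhol : HolderOnWith C r F (Set.range ψ) := by
    rintro _ ⟨ω, rfl⟩ _ ⟨ω', rfl⟩
    rw [hFψ, hFψ]
    by_cases hne : ω = ω'
    · rw [hne, edist_self]; simp
    obtain ⟨i, h1, h2⟩ := hfirst ω ω' hne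
    have h3 := hψ ω ω' i h1 h2
    have h4 : |Real.ofDigits ω - Real.ofDigits ω'| ≤ ((N : ℝ) ^ i)⁻¹ :=
      Real.abs_ofDigits_sub_ofDigits_le h1
    have h5 : dist (Real.ofDigits ω) (Real.ofDigits ω') ≤ C * dist (ψ ω) (ψ ω') ^ (r : ℝ) := by
      rw [Real.dist_eq, Real.dist_eq]
      refine h4.trans ((hC i).trans ?_)
      have := (hs i).le
      gcongr
    rw [edist_dist, edist_dist, ENNReal.ofReal_rpow_of_nonneg dist_nonneg (NNReal.coe_nonneg r),
      ← ENNReal.ofReal_coe_nnreal, ← ENNReal.ofReal_mul (NNReal.coe_nonneg C)]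
    exact ENNReal.ofReal_le_ofReal h5
  have himg : Set.Icc (0 : ℝ) 1 ⊆ F '' Set.range ψ := by
    intro y hy
    obtain ⟨ω, -, hω⟩ := Real.ofDigits_SurjOn (b := N) (by omega) hy
    exact ⟨ψ ω, ⟨ω, rfl⟩, by rw [hFψ, hω]⟩
  have hdim : dimH (Set.Icc (0 : ℝ) 1) = 1 := by
    rw [Real.dimH_of_nonempty_interior (by rw [interior_Icc]; exact ⟨1 / 2, by norm_num⟩)]
    simp
  have h1 : 1 ≤ dimH (Set.range ψ) / r := by
    rw [← hdim]
    exact (dimH_mono himg).trans (hhol.dimH_image_le hr)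
  have hr0 : (r : ℝ≥0∞) ≠ 0 := by exact_mod_cast hr.ne'
  rwa [ENNReal.le_div_iff_mul_le (Or.inl hr0) (Or.inl ENNReal.coe_ne_top), one_mul] at h1

/-! ### The schedule of insertions -/

/-- The state `(n, u, k)` of the construction after each step: the level `n`, the number `u` of free
steps since the last insertion, and the number `k` of insertions made. Insertion number `k` descends
`m k` levels and is made at the first step by which `F k` free steps have been made since the
previous insertion. -/
def sched (F m : ℕ → ℕ) : ℕ → ℕ × ℕ × ℕ
  | 0 => (0, 0, 0)
  | i + 1 =>
    if F (sched F m i).2.2 ≤ (sched F m i).2.1 + 1 then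
      ((sched F m i).1 + 1 + m (sched F m i).2.2, 0, (sched F m i).2.2 + 1)
    else ((sched F m i).1 + 1, (sched F m i).2.1 + 1, (sched F m i).2.2)

variable {F m : ℕ → ℕ}

theorem le_sched (F m : ℕ → ℕ) (i : ℕ) : i ≤ (sched F m i).1 := by
  induction i with
  | zero => exact Nat.zero_le _
  | succ i ih =>
    rw [sched]
    split_ifs <;> dsimp only <;> omega

/-- If every insertion is preceded by many free steps, then the insertions hardly contribute to the
level. -/
theorem sched_le {D : ℕ} (h : ∀ k, D * m k ≤ F k) (i : ℕ) :
    D * (sched F m i).1 + (sched F m i).2.1 ≤ (D + 1) * i := by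
  induction i with
  | zero => simp [sched]
  | succ i ih =>
    rw [sched]
    have := h (sched F m i).2.2
    split_ifs with h1 <;> dsimp only
    · nlinarith
    · nlinarith

/-- Every insertion takes place at some step. -/
theorem exists_sched_eq (F m : ℕ → ℕ) (K : ℕ) : ∃ i, (sched F m i).2.2 = K := by
  induction K with
  | zero => exact ⟨0, rfl⟩
  | succ K ih =>
    have key : ∀ v, (∃ i, (sched F m i).2.2 = K ∧ F K ≤ (sched F m i).2.1 + 1) ∨
        ∃ i, (sched F m i).2.2 = K ∧ v ≤ (sched F m i).2.1 := by
      intro v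
      induction v with
      | zero =>
        obtain ⟨i, hi⟩ := ih
        exact Or.inr ⟨i, hi, Nat.zero_le _⟩
      | succ v ihv =>
        rcases ihv with h | ⟨i, h1, h2⟩
        · exact Or.inl h
        · by_cases h3 : F K ≤ (sched F m i).2.1 + 1
          · exact Or.inl ⟨i, h1, h3⟩
          · refine Or.inr ⟨i + 1, ?_, ?_⟩ <;> rw [sched, h1, if_neg h3]
            dsimp only
            omega
    obtain ⟨i, h1, h2⟩ : ∃ i, (sched F m i).2.2 = K ∧ F K ≤ (sched F m i).2.1 + 1 := by
      rcases key (F K) with h | ⟨i, h1, h2⟩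
      · exact h
      · exact ⟨i, h1, by omega⟩
    refine ⟨i + 1, ?_⟩
    rw [sched, h1, if_pos h2]

/-! ### The dimension of the limit set -/

/-- `q |q x - p| ≥ c` for all denominators `q < b ^ n`. -/
def BadlyBelow (c : ℝ) (b n : ℕ) (x : ℝ) : Prop :=
  ∀ (p : ℤ) (q : ℕ), 0 < q → q < b ^ n → c ≤ q * |q * x - p|

/-- `|q x - p| ≥ ε / b ^ n` for all denominators `q < b ^ n`. -/
def FarBelow (ε : ℝ) (b n : ℕ) (x : ℝ) : Prop :=
  ∀ (p : ℤ) (q : ℕ), 0 < q → q < b ^ n → ε / (b : ℝ) ^ n ≤ |q * x - p|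

theorem BadlyBelow.farBelow {c x : ℝ} {b n : ℕ} (h : BadlyBelow c b n x) :
    FarBelow c b n x := by
  intro p q hq hqb
  have hqr : (q : ℝ) < b ^ n := by exact_mod_cast hqb
  have hq0 : (0 : ℝ) < q := by exact_mod_cast hq
  rw [div_le_iff₀ (by linarith)]
  have h1 := h p q hq hqb
  nlinarith [abs_nonneg (q * x - p)]

theorem FarBelow.mono {ε ε' x : ℝ} {b n : ℕ} (h : FarBelow ε b n x) (hε : ε' ≤ ε) :
    FarBelow ε' b n x := fun p q hq hqb =>
  le_trans (by gcongr) (h p q hq hqb)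

theorem BadlyBelow.succ {c x : ℝ} {b n : ℕ} (hb : 0 < b) (hc : c ≤ 1 / (2 * (b : ℝ) ^ 4))
    (h : BadlyBelow c b n x)
    (hx : ∀ (p : ℤ) (q : ℕ), 0 < q → q < b ^ (n + 1) → q * width b (n + 1) ≤ |q * x - p|) :
    BadlyBelow c b (n + 1) x := by
  intro p q hq hqb
  rcases lt_or_ge q (b ^ n) with hlt | hge
  · exact h p q hq hlt
  · have hger : (b : ℝ) ^ n ≤ q := by exact_mod_cast hge
    have hw := (width_pos hb (n + 1)).le
    calc c ≤ 1 / (2 * (b : ℝ) ^ 4) := hc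
      _ = b ^ n * (b ^ n * width b (n + 1)) := by unfold width; field_simp; ring
      _ ≤ q * (q * width b (n + 1)) := by gcongr
      _ ≤ _ := by gcongr; exact hx p q hq hqb

/-- Free steps restore a bound that does not remember the earlier insertions. -/
theorem FarBelow.succ {ε x : ℝ} {b n : ℕ} (hb : 0 < b) (h : FarBelow ε b n x)
    (hx : ∀ (p : ℤ) (q : ℕ), 0 < q → q < b ^ (n + 1) → q * width b (n + 1) ≤ |q * x - p|) :
    FarBelow (min (1 / (2 * (b : ℝ) ^ 3)) (ε * b)) b (n + 1) x := by
  intro p q hq hqb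
  rcases lt_or_ge q (b ^ n) with hlt | hge
  · refine le_trans ?_ (h p q hq hlt)
    calc min (1 / (2 * (b : ℝ) ^ 3)) (ε * b) / (b : ℝ) ^ (n + 1) ≤ ε * b / (b : ℝ) ^ (n + 1) := by
          gcongr; exact min_le_right _ _
      _ = _ := by field_simp; ring
  · have hger : (b : ℝ) ^ n ≤ q := by exact_mod_cast hge
    have hw := (width_pos hb (n + 1)).le
    refine le_trans ?_ (hx p q hq hqb)
    calc min (1 / (2 * (b : ℝ) ^ 3)) (ε * b) / (b : ℝ) ^ (n + 1)
        ≤ 1 / (2 * (b : ℝ) ^ 3) / (b : ℝ) ^ (n + 1) := by gcongr; exact min_le_left _ _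
      _ = b ^ n * width b (n + 1) := by unfold width; field_simp; ring
      _ ≤ q * width b (n + 1) := by gcongr

/-- The number of digits can be chosen so large that the proportion of children lost at a free step
costs arbitrarily little dimension. -/
theorem exists_base {r : ℝ} (hr : r < 1) :
    ∃ ρ : ℕ, 4 ≤ ρ ∧ (4 * (ρ : ℝ) ^ 2) ^ r ≤ ρ ^ 2 - 1 := by
  have h := (tendsto_rpow_atTop (by linarith : 0 < 1 - r)).eventually_ge_atTop 8
  obtain ⟨x₀, hx₀⟩ := Filter.eventually_atTop.1 h
  obtain ⟨ρ, hρ⟩ := exists_nat_ge (max 4 x₀)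
  have h4 : (4 : ℝ) ≤ ρ := (le_max_left _ _).trans hρ
  have hx : x₀ ≤ ρ := (le_max_right _ _).trans hρ
  refine ⟨ρ, by exact_mod_cast h4, ?_⟩
  have hpos : 0 < 4 * (ρ : ℝ) ^ 2 := by positivity
  have h1 := hx₀ (4 * (ρ : ℝ) ^ 2) (by nlinarith)
  have h2 : (4 * (ρ : ℝ) ^ 2) ^ r * (4 * (ρ : ℝ) ^ 2) ^ (1 - r) = 4 * ρ ^ 2 := by
    rw [← Real.rpow_add hpos]; simp
  have h3 : 0 < (4 * (ρ : ℝ) ^ 2) ^ r := by positivity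
  nlinarith

theorem le_dimH_limitSet {g : G} {c : ℝ} (hc : 0 < c)
    (hg : ∀ m n : ℤ, ¬ (m = 0 ∧ n = 0) → c ≤ |vec g m n 0 * vec g m n 1|)
    {r : ℝ≥0} (hr0 : 0 < r) (hr1 : r < 1) :
    (r : ℝ≥0∞) ≤ dimH (limitSet (toLattice g)) := by
  have hr0' : (0 : ℝ) < r := by exact_mod_cast hr0
  have hr1' : (r : ℝ) < 1 := by exact_mod_cast hr1
  -- the loss in dimension is split between the choice of the base `b` and that of the sparsity `D`
  set r' : ℝ := (1 + r) / 2 with hr'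
  obtain ⟨D, hD⟩ := exists_nat_gt (r / (r' - r))
  have hD0 : (0 : ℝ) < D := lt_trans (div_pos hr0' (by linarith)) hD
  have hDr : (r : ℝ) * (D + 1) ≤ r' * D := by
    rw [div_lt_iff₀ (by linarith)] at hD
    linarith
  obtain ⟨ρ, hρ4, hρ⟩ := exists_base (by linarith : r' < 1)
  set b : ℕ := 2 * ρ with hb
  set N : ℕ := ρ ^ 2 - 1 with hN
  have hρ2 : 16 ≤ ρ ^ 2 := by nlinarith
  have hbN : b ^ 2 = 4 * (N + 1) := by
    rw [hN, Nat.sub_add_cancel (by omega), hb]; ring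
  have hb8 : 8 ≤ b := by omega
  have hb0 : 0 < b := by omega
  have hb1 : (1 : ℝ) < b := by exact_mod_cast (by omega : 1 < b)
  have hbN' : ((b : ℝ) ^ 2) ^ r' ≤ N := by
    have e1 : (b : ℝ) ^ 2 = 4 * (ρ : ℝ) ^ 2 := by rw [hb]; push_cast; ring
    have e2 : (N : ℝ) = (ρ : ℝ) ^ 2 - 1 := by rw [hN, Nat.cast_sub (by omega)]; push_cast; ring
    rw [e1, e2]; exact hρ
  obtain ⟨c', hc', hc'b, hins⟩ := exists_insertion hc hg hb8 hbN
  choose m hm using fun k : ℕ => hins (1 / ((k : ℝ) + 1)) (by positivity)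
  obtain ⟨B, hB⟩ := pow_unbounded_of_one_lt (1 / (2 * (b : ℝ) ^ 3) / c') hb1
  rw [div_lt_iff₀ hc'] at hB
  set F : ℕ → ℕ := fun k => D * m k + B with hF
  set ε : ℝ := 1 / (2 * (b : ℝ) ^ 3) with hε
  set L := toLattice g with hL
  set Q : ℕ → ℝ → Prop := fun i x => BadlyBelow c' b (sched F m i).1 x ∧
    FarBelow (min ε (c' * b ^ (sched F m i).2.1)) b (sched F m i).1 x ∧
    ∀ k < (sched F m i).2.2, Hits L (1 / ((k : ℝ) + 1)) x with hQ
  obtain ⟨ψ, hψQ, hψs⟩ := exists_cantor (N := N) (w := fun i => width b (sched F m i).1)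
    (s := fun i => width b ((sched F m i).1 + 1)) (fun i => (width_pos hb0 _).le) (Q := Q) 0
    (by
      intro x _
      have h0 : sched F m 0 = (0, 0, 0) := rfl
      refine ⟨fun p q h1 h2 => ?_, fun p q h1 h2 => ?_, fun k hk => ?_⟩
      · rw [h0, pow_zero] at h2; omega
      · rw [h0, pow_zero] at h2; omega
      · rw [h0] at hk; exact absurd hk (Nat.not_lt_zero _))
    (by
      intro i a hQi
      obtain ⟨f, hf1, hf2, hf3⟩ := exists_children hbN (sched F m i).1 a
      have hBad : ∀ d, ∀ x ∈ Set.Icc (f d) (f d + width b ((sched F m i).1 + 1)),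
          BadlyBelow c' b ((sched F m i).1 + 1) x := fun d x hx =>
        (hQi x (hf1 d hx)).1.succ hb0 hc'b (hf3 d x hx)
      have hFar : ∀ d, ∀ x ∈ Set.Icc (f d) (f d + width b ((sched F m i).1 + 1)),
          FarBelow (min ε (c' * b ^ ((sched F m i).2.1 + 1))) b ((sched F m i).1 + 1) x := by
        intro d x hx
        refine ((hQi x (hf1 d hx)).2.1.succ hb0 (hf3 d x hx)).mono (le_min (min_le_left _ _) ?_)
        rw [min_mul_of_nonneg _ _ (by positivity), pow_succ, ← mul_assoc]
        refine min_le_min_right _ (le_mul_of_one_le_right (by positivity) hb1.le)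
      by_cases hcase : F (sched F m i).2.2 ≤ (sched F m i).2.1 + 1
      · -- an insertion follows the free step
        have hs : sched F m (i + 1) = ((sched F m i).1 + 1 + m (sched F m i).2.2, 0,
          (sched F m i).2.2 + 1) := by rw [sched, if_pos hcase]
        have hsmall : ε ≤ c' * b ^ ((sched F m i).2.1 + 1) := by
          have h1 : (b : ℝ) ^ B ≤ b ^ ((sched F m i).2.1 + 1) :=
            pow_le_pow_right₀ hb1.le (le_trans (Nat.le_add_left _ _) hcase)
          nlinarith
        choose f' hf'1 hf'2 using fun d => hm (sched F m i).2.2 ((sched F m i).1 + 1) (f d) (by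
          intro x hx p q hq hqb
          have h1 := hFar d x hx p q hq hqb
          rw [min_eq_left hsmall, hε, div_div] at h1
          exact h1)
        refine ⟨f', ?_, ?_, ?_⟩ <;> simp only [hs]
        · exact fun d => (hf'1 d).trans (hf1 d)
        · exact fun d d' hd x hx y hy => hf2 d d' hd x (hf'1 d hx) y (hf'1 d' hy)
        · intro d x hx
          have hx1 := hf'1 d hx
          have hbad : BadlyBelow c' b (sched F m (i + 1)).1 x := by
            rw [hs]
            intro p q hq hqb
            rcases lt_or_ge q (b ^ ((sched F m i).1 + 1)) with hlt | hge
            · exact hBad d x hx1 p q hq hlt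
            · exact (hf'2 d x hx).2 p q hge hqb
          refine ⟨hbad, ?_, ?_⟩
          · rw [hs]
            rw [hs] at hbad
            simp only [pow_zero, mul_one]
            exact hbad.farBelow.mono (min_le_right _ _)
          · rw [hs]
            intro k hk
            rcases Nat.lt_succ_iff_lt_or_eq.1 hk with h1 | h1
            · exact (hQi x (hf1 d hx1)).2.2 k h1
            · rw [h1]; exact (hf'2 d x hx).1
      · have hs : sched F m (i + 1) = ((sched F m i).1 + 1, (sched F m i).2.1 + 1,
          (sched F m i).2.2) := by rw [sched, if_neg hcase]
        refine ⟨f, ?_, ?_, ?_⟩ <;> simp only [hs]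
        · exact hf1
        · exact hf2
        · intro d x hx
          refine ⟨?_, ?_, ?_⟩ <;> rw [hs]
          · exact hBad d x hx
          · exact hFar d x hx
          · exact (hQi x (hf1 d hx)).2.2)
  have hsub : Set.range ψ ⊆ limitSet L := by
    rintro _ ⟨ω, rfl⟩
    constructor
    · refine mem_BA_of_isBadly hc' fun p q hq => ?_
      obtain ⟨i, hi⟩ := pow_unbounded_of_one_lt (q : ℝ) hb1
      refine (hψQ ω i).1 p q hq ?_
      have h1 : q < b ^ i := by exact_mod_cast hi
      exact h1.trans_le (Nat.pow_le_pow_right hb0 (le_sched F m i))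
    · refine mem_closure_of_hits fun δ hδ => ?_
      obtain ⟨k, hk⟩ := exists_nat_one_div_lt hδ
      obtain ⟨i, hi⟩ := exists_sched_eq F m (k + 1)
      exact ((hψQ ω i).2.2 k (by rw [hi]; exact Nat.lt_succ_self k)).mono hk.le
  refine le_trans (le_dimH_range (N := N) (by omega) (fun i => width_pos hb0 _) hψs
    (C := ⟨(2 * (b : ℝ) ^ 4) ^ (r : ℝ), by positivity⟩) hr0 fun i => ?_) (dimH_mono hsub)
  -- the level after `i` steps is at most `(1 + 1 / D) i`
  have hlev : (D : ℝ) * (sched F m i).1 ≤ (D + 1) * i := by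
    have h1 := sched_le (F := F) (m := m) (D := D) (fun k => Nat.le_add_right _ _) i
    have h2 : D * (sched F m i).1 ≤ (D + 1) * i := le_trans (Nat.le_add_right _ _) h1
    exact_mod_cast h2
  have hexp : (r : ℝ) * (sched F m i).1 ≤ r' * i := by
    have h1 : (r : ℝ) * (D * (sched F m i).1) ≤ r * ((D + 1) * i) := by gcongr
    have h2 : (r : ℝ) * (D + 1) * i ≤ r' * D * i := by gcongr
    have h3 : (D : ℝ) * (r * (sched F m i).1) ≤ D * (r' * i) := by linarith
    exact le_of_mul_le_mul_left h3 hD0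
  have hbb : (0 : ℝ) < b := by linarith
  have hwid : width b ((sched F m i).1 + 1) =
      (2 * (b : ℝ) ^ 4)⁻¹ * (((b : ℝ) ^ 2) ^ (sched F m i).1)⁻¹ := by
    unfold width; field_simp; ring
  have hpow : (((b : ℝ) ^ 2) ^ (sched F m i).1) ^ (r : ℝ) ≤ (N : ℝ) ^ i := by
    calc (((b : ℝ) ^ 2) ^ (sched F m i).1) ^ (r : ℝ)
        = ((b : ℝ) ^ 2) ^ ((r : ℝ) * (sched F m i).1) := by
          rw [← Real.rpow_natCast, ← Real.rpow_mul (by positivity), mul_comm]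
      _ ≤ ((b : ℝ) ^ 2) ^ (r' * i) :=
          Real.rpow_le_rpow_of_exponent_le (one_le_pow₀ hb1.le) hexp
      _ = (((b : ℝ) ^ 2) ^ r') ^ i := by rw [Real.rpow_mul (by positivity), Real.rpow_natCast]
      _ ≤ (N : ℝ) ^ i := by gcongr
  change ((N : ℝ) ^ i)⁻¹ ≤ (2 * (b : ℝ) ^ 4) ^ (r : ℝ) * width b ((sched F m i).1 + 1) ^ (r : ℝ)
  rw [hwid, ← Real.mul_rpow (by positivity) (by positivity), mul_inv_cancel_left₀ (by positivity),
    Real.inv_rpow (by positivity)]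
  exact inv_anti₀ (by positivity) hpow

theorem dimH_limitSet_of_precompact {L : X} (hL : Precompact (orbit Set.univ L)) :
    dimH (limitSet L) = 1 := by
  obtain ⟨g, rfl⟩ := exists_toLattice L
  obtain ⟨c, hc, hg⟩ := exists_le_abs_mul_of_precompact hL
  refine le_antisymm ((dimH_mono (Set.subset_univ _)).trans Real.dimH_univ.le) ?_
  refine le_of_forall_lt fun d hd => ?_
  obtain ⟨r, hdr, hr1⟩ := ENNReal.lt_iff_exists_nnreal_btwn.1 hd
  have hr0 : (0 : ℝ≥0∞) < r := lt_of_le_of_lt bot_le hdr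
  exact hdr.trans_le (le_dimH_limitSet hc hg (by exact_mod_cast hr0) (by exact_mod_cast hr1))

end LatticeFlow

theorem mainTheorem1 (L : LatticeFlow.X) :
    (LatticeFlow.Precompact (LatticeFlow.orbit Set.univ L) →
      dimH (LatticeFlow.limitSet L) = 1) ∧
    (¬ LatticeFlow.Precompact (LatticeFlow.orbit Set.univ L) →
      ∀ α ∈ LatticeFlow.BA, ∃ t₀ : ℝ, 0 < t₀ ∧ ∃ U ∈ 𝓝 L,
        LatticeFlow.orbit (Set.Ioi t₀) (LatticeFlow.latticeOf α) ∩ U = ∅) :=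
  ⟨LatticeFlow.dimH_limitSet_of_precompact,
    fun h _ hα => LatticeFlow.exists_disjoint_nhds_of_not_precompact h hα⟩
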